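/- Let $G$ be a polyhedron of type $3_n$, that is, a $3$-connected simple plane graph with $n$ vertices, all of degree $3$, each of whose faces is a triangle or a hexagon, with at least one triangle. A zigzag of $G$ is a circuit of edges (considered up to reversal) that turns alternately left and right at its successive vertices; each edge is passed exactly twice by zigzags. A zigzag is simple if it passes no edge twice. Otherwise, each edge that it passes twice is of type I or of type II, according to whether the two passages have opposite directions or the same direction, and the signature of a zigzag is the pair (number of its edges of type I, number of its edges of type II). The $z$-vector of $G$ is the multiset of the lengths of its zigzags, with their signatures (the signature $(0,0)$ of simple zigzags being omitted); $l^m$ stands for $m$ simple zigzags of length $l$. A railroad is a circuit of hexagonal faces (up to reversal) in which each hexagon is adjacent to its two neighbours on opposite edges; it is bounded by two zigzags, one on each side, each containing the two edges on that side of every hexagon passed. $G$ is tight if it has no railroad. The intersection $Z\cap Z'$ of two distinct zigzags is the set of their common edges, and $G$ is $z$-balanced if any two zigzags with the same length and the same signature have the same multiset of sizes of intersection with all the other zigzags. Then all zigzags of $G$ are simple, and the following holds. Let $e_1,e_2,e_3$ be the edges, in any order, of any triangle of $G$. There are positive integers $m_1,m_2,m_3$, integers $s_1,s_2,s_3$,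 and an enumeration without repetition $Z_{i,k}$ ($1\le i\le 3$, $1\le k\le m_i$) of all zigzags of $G$, and an enumeration without repetition $R_{i,k}$ ($1\le i\le 3$, $1\le k\le m_i-1$) of all railroads of $G$, such that $Z_{i,1}$ is the zigzag containing the two edges of the triangle other than $e_i$, the railroad $R_{i,k}$ is bounded by $Z_{i,k}$ and $Z_{i,k+1}$, each $Z_{i,k}$ has length $4s_i$, and: (i) the $z$-vector of $G$ is $(4s_1)^{m_1},(4s_2)^{m_2},(4s_3)^{m_3}$, and the number of railroads is $m_1+m_2+m_3-3$; (ii) $G$ has at least three zigzags, with equality if and only if $G$ is tight; (iii) if $G$ is tight, then its $z$-vector is $n^3$, and each of its three zigzags is a Hamiltonian circuit; (iv) $G$ is $z$-balanced, and $$|Z_{i,k}\cap Z_{j,l}|=\begin{cases}0 & \text{if } i=j \text{ and } k\neq l,\\[2pt] \dfrac{n}{2m_im_j} & \text{if } i\neq j.\end{cases}$$ -/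

import Mathlib

/-- A rotation system on a simple graph `G`: for every vertex a cyclic (counter-clockwise) order on
the darts (oriented edges) leaving it. It encodes a cellular drawing of a connected graph on a
closed oriented surface, up to orientation-preserving homeomorphism. -/
structure RotationSystem {V : Type*} (G : SimpleGraph V) where
  /-- the next dart, counter-clockwise, with the same origin -/
  rot : Equiv.Perm G.Dart
  fst_rot : ∀ d : G.Dart, (rot d).fst = d.fst
  sameCycle : ∀ d d' : G.Dart, d.fst = d'.fst → rot.SameCycle d d'

/-- A graph is `3`-connected if it has at least four vertices and stays connected after the
removal of any set of at most two vertices. -/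
def SimpleGraph.IsThreeConnected {V : Type*} (G : SimpleGraph V) : Prop :=
  4 ≤ Nat.card V ∧ ∀ S : Finset V, S.card ≤ 2 → (G.induce {v | v ∉ S}).Connected

namespace RotationSystem

section

variable {V : Type*} {G : SimpleGraph V} (M : RotationSystem G)

/-- The successor of a dart on the boundary of the face on its left, that boundary being traversed
with the face on the left. -/
def faceNext : Equiv.Perm G.Dart :=
  SimpleGraph.Dart.symm_involutive.toPerm.trans M.rot.symm

/-- The faces: the cycles of `faceNext`. -/
def Face : Type _ := Quotient (Equiv.Perm.SameCycle.setoid M.faceNext)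

/-- The face on the left of a dart. -/
def face (d : G.Dart) : M.Face := Quotient.mk (Equiv.Perm.SameCycle.setoid M.faceNext) d

/-- The number of sides of the face on the left of a dart. -/
noncomputable def faceDegree (d : G.Dart) : ℕ := Function.minimalPeriod M.faceNext d

/-- The drawing is a plane (equivalently, spherical) one: the graph is connected and Euler's
relation (vertices) + (faces) = (edges) + 2 holds. -/
def IsPlane : Prop :=
  G.Connected ∧ Nat.card V + Nat.card M.Face = Nat.card G.edgeSet + 2

/-- A polyhedron of type `3_n`: a `3`-connected simple plane graph with `n` vertices, all of degree
`3`, each face of which is a triangle or a hexagon, triangles being present. -/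
structure IsType3 (n : ℕ) : Prop where
  isPlane : M.IsPlane
  isThreeConnected : G.IsThreeConnected
  card_eq : Nat.card V = n
  cubic : ∀ v : V, (G.neighborSet v).ncard = 3
  faceDegree_eq : ∀ d : G.Dart, M.faceDegree d = 3 ∨ M.faceDegree d = 6
  exists_triangle : ∃ d : G.Dart, M.faceDegree d = 3

/-! ### Zigzags

A state `(d, b)` of a left-right walk means: the dart `d` is being traversed, and at its end vertex
the walk turns left if `b = true` and right if `b = false`. -/

/-- One step of the left-right walk: at the end of `d`, take the left neighbour or the right
neighbour of the edge just traversed, and take the other kind of turn next time. -/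
def zigzagStep : G.Dart × Bool → G.Dart × Bool
  | (d, true) => (M.rot d.symm, false)
  | (d, false) => (M.rot.symm d.symm, true)

/-- The zigzags (as unoriented circuits): classes of states under stepping along the walk and under
reversal of the walk. Reversing exchanges left and right as well as the two ends of `d`, so that the
reversed walk traverses `d.symm` in the state `(d.symm, b)`. -/
def Zigzag : Type _ :=
  Quot (fun x y : G.Dart × Bool => y = M.zigzagStep x ∨ y = (x.1.symm, x.2))

/-- The zigzag containing a given state. -/
def zigzag (x : G.Dart × Bool) : M.Zigzag := Quot.mk _ x

/-- The zigzag containing two consecutive edges of the face on the left of `d`: the successor of `d`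
and the successor of that one (the turn between them is a right turn, in the sense that the
second edge is the clockwise neighbour of the first one at their common vertex). If the face is a
triangle, these are the two edges other than that of `d`. -/
def zigzagBeside (d : G.Dart) : M.Zigzag := M.zigzag (M.faceNext d, false)

variable {M}

/-- The passages of a zigzag through edges. An edge `e` is passed exactly twice by zigzags, once
with each value of `b`; a zigzag may account for both passages. -/
def Zigzag.passages (Z : M.Zigzag) : Set (Sym2 V × Bool) :=
  {p | ∃ d : G.Dart, d.edge = p.1 ∧ M.zigzag (d, p.2) = Z}

/-- The length of a zigzag: its number of edges, counted with multiplicity. -/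
noncomputable def Zigzag.length (Z : M.Zigzag) : ℕ := Z.passages.ncard

/-- The set of edges of a zigzag. -/
def Zigzag.edges (Z : M.Zigzag) : Set (Sym2 V) := {e | ∃ b : Bool, (e, b) ∈ Z.passages}

/-- A zigzag is simple if it has no self-intersection, that is, passes no edge twice. -/
def Zigzag.IsSimple (Z : M.Zigzag) : Prop :=
  ∀ e : Sym2 V, ¬ ((e, true) ∈ Z.passages ∧ (e, false) ∈ Z.passages)

/-- The self-intersection edges of type I: the (oriented) zigzag traverses them twice, in opposite
directions. -/
def Zigzag.typeI (Z : M.Zigzag) : Set (Sym2 V) :=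
  {e | ∃ d : G.Dart, d.edge = e ∧ M.zigzag (d, true) = Z ∧
    ∃ k : ℕ, M.zigzagStep^[k] (d, true) = (d.symm, false)}

/-- The self-intersection edges of type II: the (oriented) zigzag traverses them twice, in the same
direction. -/
def Zigzag.typeII (Z : M.Zigzag) : Set (Sym2 V) :=
  {e | ∃ d : G.Dart, d.edge = e ∧ M.zigzag (d, true) = Z ∧
    ∃ k : ℕ, M.zigzagStep^[k] (d, true) = (d, false)}

/-- The signature of a zigzag. -/
noncomputable def Zigzag.signature (Z : M.Zigzag) : ℕ × ℕ := (Z.typeI.ncard, Z.typeII.ncard)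

/-- A zigzag is a Hamiltonian circuit: its edges are those of a Hamiltonian cycle of the graph, and
it passes each of them once. -/
def Zigzag.IsHamiltonian [DecidableEq V] (Z : M.Zigzag) : Prop :=
  Z.IsSimple ∧ ∃ (v : V) (c : G.Walk v v), c.IsHamiltonianCycle ∧ {e | e ∈ c.edges} = Z.edges

variable (M)

instance finite_zigzag [Finite V] : Finite M.Zigzag :=
  have : Finite G.Dart :=
    Finite.of_injective SimpleGraph.Dart.toProd SimpleGraph.Dart.toProd_injective
  inferInstanceAs (Finite (Quot _))

noncomputable instance fintypeZigzag [Finite V] : Fintype M.Zigzag := Fintype.ofFinite _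

/-- The `z`-vector: the lengths of all zigzags, with their signatures, as a multiset. -/
noncomputable def zVector [Finite V] : Multiset (ℕ × (ℕ × ℕ)) :=
  (Finset.univ : Finset M.Zigzag).val.map fun Z => (Z.length, Z.signature)

variable {M}

open Classical in
/-- The intersection vector of a zigzag: the sizes of its intersections with all other zigzags, as a
multiset. -/
noncomputable def Zigzag.intersectionVector [Finite V] (Z : M.Zigzag) : Multiset ℕ :=
  ((Finset.univ : Finset M.Zigzag).erase Z).val.map fun Z' => (Z.edges ∩ Z'.edges).ncard

variable (M)

/-- All zigzags of the same length and the same signature have the same intersection vector. -/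
def IsZBalanced [Finite V] : Prop :=
  ∀ Z Z' : M.Zigzag, Z.length = Z'.length → Z.signature = Z'.signature →
    Z.intersectionVector = Z'.intersectionVector

/-! ### Railroads

A road is walked through by crossing an edge into the face on its other side, and by passing inside
a hexagon from an edge to the opposite edge (three steps further on the boundary). -/

/-- Roads, as unoriented objects: classes of darts under crossing an edge and under passing to the
third successor on the boundary of the face on the left (in a hexagon, the opposite edge). -/
def Road : Type _ :=
  Quot (fun d d' : G.Dart => d' = d.symm ∨ d' = (M.faceNext)^[3] d)

/-- The road through the edge of a dart and the face on the left of it. -/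
def road (d : G.Dart) : M.Road := Quot.mk _ d

/-- The railroads: the roads that run through hexagonal faces only. They are the circuits of hexagons
in which each hexagon is adjacent to its two neighbours on opposite edges. -/
def Railroad : Type _ := {R : M.Road // ∀ d : G.Dart, M.road d = R → M.faceDegree d = 6}

/-- A plane graph is tight if it has no railroad. -/
def IsTight : Prop := IsEmpty M.Railroad

variable {M}

/-- The railroad `R` is bounded by the two zigzags `Z` and `Z'`: if `R` enters a hexagon through `d`
and leaves it through the opposite edge, then `Z` contains the two edges of the hexagon on one side,
and `Z'` contains the two edges on the other side. -/
def Railroad.IsBoundedBy (R : M.Railroad) (Z Z' : M.Zigzag) : Prop :=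
  ∃ d : G.Dart, M.road d = R.1 ∧ Z = M.zigzagBeside d ∧ Z' = M.zigzagBeside ((M.faceNext)^[3] d)

end

end RotationSystem

/-! A triangle can be read as a hexagon wrapped twice. With this reading `faceNext` φ and dart
reversal α satisfy φ⁶ = α² = (φα)³ = 1, the relations of the rotation group of the hexagonal tiling.
So the darts of the tiling map onto those of `G` (`unfold`, `symm_unfold`, `exists_unfold_eq`). Base
the map at a dart of a triangle. Rotations of order 6 or 3 cannot be symmetries of it, since they
would force a face of degree 1 or 2 or a dart fixed by `rot`. The symmetries are therefore the
translations by a subgroup L of the lattice of hexagon centres, together with half-turns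
(`unfold_eq_unfold_iff`): `G` is the tiling modulo L ⋊ {±1}. A half-turn about the midpoint of an
edge would make a dart its own reverse, so every half-turn is about a hexagon centre and L ⊆ 2ℤ².
The index of L is n (`index_translations`).

Zigzags of the tiling are the straight strips between adjacent lattice lines, and roads are the
lattice lines themselves. Both have one of three directions, which the symmetries preserve. The two
passages of an edge have different directions, so all zigzags are simple and parallel ones are
disjoint. In direction j, let 2m be the generator of the heights of L. Strips are classified by
their mid-height modulo 2m and up to sign, which gives m zigzags (`strip_eq_strip_iff`). Lines are
classified by their height in the same way (`road_unfold_eq_road_unfold_iff`). Triangles lie at the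
heights divisible by m, so the railroads are the m − 1 lines strictly between, each bounded by the
two neighbouring strips.

Sizes come from counting fibres of the height homomorphisms on ℤ²/L. One height gives the length n/m
(`length_strip_mul_width`). Two heights of different directions give the intersection n/(2mm')
(`ncard_inter_edges`). Tightness means m = 1 in every direction; each zigzag then has n steps and
repeats no vertex. -/

/-! ### The triangular lattice of hexagon centres and its heights. -/

/-- The six unit vectors of the triangular lattice, in counter-clockwise order, in the basis formed
by the first two. -/
def hexUnit (j : ZMod 6) : ℤ × ℤ :=
  (![1, 0, -1, -1, 0, 1] j, ![0, 1, 1, 0, -1, -1] j)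

/-- The height of a point of the triangular lattice above the line through the origin in the
direction of `hexUnit j`. -/
def hexHeight (j : ZMod 6) : ℤ × ℤ →+ ℤ where
  toFun p := (hexUnit j).1 * p.2 - (hexUnit j).2 * p.1
  map_zero' := by simp
  map_add' p q := by simp; ring

theorem hexHeight_apply (j : ZMod 6) (p : ℤ × ℤ) :
    hexHeight j p = (hexUnit j).1 * p.2 - (hexUnit j).2 * p.1 := rfl

theorem hexUnit_add_three : ∀ j, hexUnit (j + 3) = -hexUnit j := by decide

theorem hexUnit_add_hexUnit_add_two : ∀ j, hexUnit j + hexUnit (j + 2) = hexUnit (j + 1) := by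
  decide

theorem hexHeight_hexUnit_self (j : ZMod 6) : hexHeight j (hexUnit j) = 0 := by
  rw [hexHeight_apply]; ring

theorem hexHeight_hexUnit_add_one (j : ZMod 6) : hexHeight j (hexUnit (j + 1)) = 1 := by
  rw [hexHeight_apply]; revert j; decide

theorem hexHeight_add_one_hexUnit (j : ZMod 6) : hexHeight (j + 1) (hexUnit j) = -1 := by
  rw [hexHeight_apply]; revert j; decide

theorem hexHeight_add_two_hexUnit (j : ZMod 6) : hexHeight (j + 2) (hexUnit j) = -1 := by
  rw [hexHeight_apply]; revert j; decide

theorem hexHeight_add_three (j : ZMod 6) (p : ℤ × ℤ) : hexHeight (j + 3) p = -hexHeight j p := by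
  simp only [hexHeight_apply, hexUnit_add_three, Prod.fst_neg, Prod.snd_neg]; ring

/-- A lattice point is determined by two heights. -/
theorem eq_smul_hexUnit_add_smul_hexUnit (j : ZMod 6) (p : ℤ × ℤ) :
    p = -hexHeight (j + 1) p • hexUnit j + hexHeight j p • hexUnit (j + 1) := by
  obtain ⟨x, y⟩ := p
  have : j = 0 ∨ j = 1 ∨ j = 2 ∨ j = 3 ∨ j = 4 ∨ j = 5 := by revert j; decide
  simp only [hexHeight_apply]
  rcases this with rfl | rfl | rfl | rfl | rfl | rfl <;> ext <;>
    simp [hexUnit, show (1 + 1 : ZMod 6) = 2 from rfl, show (2 + 1 : ZMod 6) = 3 from rfl,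
      show (3 + 1 : ZMod 6) = 4 from rfl, show (4 + 1 : ZMod 6) = 5 from rfl,
      show (5 + 1 : ZMod 6) = 0 from rfl]

theorem exists_eq_smul_hexUnit {j : ZMod 6} {p : ℤ × ℤ} (h : hexHeight j p = 0) :
    ∃ t : ℤ, p = t • hexUnit j :=
  ⟨_, by
    have := eq_smul_hexUnit_add_smul_hexUnit j p
    rwa [h, zero_smul, add_zero] at this⟩

/-! ### The rotation group of the hexagonal tiling, by generators and relations. -/

section HexagonalGroup

variable {Γ : Type*} [Group Γ] {φ α : Γ}

theorem mul_mul_eq_of_relations (hα : α * α = 1) (hφα : (φ * α) ^ 3 = 1) :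
    φ * α * φ = α * φ⁻¹ * α := by
  have hα' : α⁻¹ = α := inv_eq_of_mul_eq_one_left hα
  have : φ * α * φ * (α * φ * α) = 1 := by
    rw [← hφα]; simp only [pow_succ, pow_zero, one_mul, mul_assoc]
  rw [eq_inv_of_mul_eq_one_left this]
  simp [hα', mul_assoc]

theorem inv_mul_mul_of_relations (hα : α * α = 1) (hφα : (φ * α) ^ 3 = 1) :
    φ⁻¹ * (φ ^ 2 * α * φ) * φ = (φ ^ 3 * α)⁻¹ * (φ ^ 2 * α * φ) := by
  have hα' : α⁻¹ = α := inv_eq_of_mul_eq_one_left hα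
  calc _ = (φ * α * φ) * φ := by group
    _ = α * φ⁻¹ * α * φ := by rw [mul_mul_eq_of_relations hα hφα]
    _ = α⁻¹ * φ⁻¹ * α * φ := by rw [hα']
    _ = _ := by group

/-- The two elements play the part of the unit translations along the first two lattice directions.
-/
theorem commute_of_relations (hα : α * α = 1) (hφ : φ ^ 6 = 1) (hφα : (φ * α) ^ 3 = 1) :
    Commute (φ ^ 3 * α) (φ ^ 2 * α * φ) := by
  have key := mul_mul_eq_of_relations hα hφα
  have h4 : φ⁻¹ * φ⁻¹ = φ ^ 4 := by
    rw [← mul_right_inj (φ ^ 2), ← pow_add, hφ]; group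
  calc _ = φ ^ 2 * ((φ * α * φ) * (φ * α * φ)) := by
        simp only [pow_succ, pow_zero, one_mul, mul_assoc]
    _ = φ ^ 2 * (α * φ⁻¹ * (α * α) * φ⁻¹ * α) := by rw [key]; group
    _ = φ ^ 2 * (α * (φ⁻¹ * φ⁻¹) * α) := by rw [hα]; group
    _ = φ ^ 2 * (α * φ ^ 4 * α) := by rw [h4]
    _ = _ := by group

/-- Conjugation by φ turns the lattice by one sixth: it sends a to b and b to a⁻¹b. Iterating it
sends the translation a to the translation by `hexUnit j`. -/
theorem mul_pow_of_relations (hα : α * α = 1) (hφ : φ ^ 6 = 1) (hφα : (φ * α) ^ 3 = 1)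
    (j : ZMod 6) : φ ^ 3 * α * φ ^ j.val =
      φ ^ j.val * ((φ ^ 3 * α) ^ (hexUnit j).1 * (φ ^ 2 * α * φ) ^ (hexUnit j).2) := by
  have hB := inv_mul_mul_of_relations hα hφα
  have hA : φ⁻¹ * (φ ^ 3 * α) * φ = φ ^ 2 * α * φ := by group
  have hc := commute_of_relations hα hφ hφα
  generalize φ ^ 3 * α = a at *
  generalize φ ^ 2 * α * φ = b at *
  have hc1 : a⁻¹ * b = b * a⁻¹ := hc.inv_left.eq
  have h1 : a * φ = φ * b := by rw [← hA]; group
  have h2 : b * φ = φ * (a⁻¹ * b) := by rw [← hB]; group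
  have hai : a⁻¹ * φ = φ * b⁻¹ := by
    rw [inv_mul_eq_iff_eq_mul, ← mul_assoc, h1, mul_assoc, mul_inv_cancel, mul_one]
  have hbi : b⁻¹ * φ = φ * (b⁻¹ * a) := by
    rw [inv_mul_eq_iff_eq_mul, ← mul_assoc, h2]; group
  have e2 : a * φ ^ 2 = φ ^ 2 * (a⁻¹ * b) := by
    rw [pow_two, ← mul_assoc, h1, mul_assoc, h2, mul_assoc]
  have e3 : a * φ ^ 3 = φ ^ 3 * a⁻¹ := by
    rw [pow_succ, ← mul_assoc, e2, mul_assoc, mul_assoc, h2, ← mul_assoc a⁻¹, hai,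
      mul_assoc φ, hc1]
    group
  have e4 : a * φ ^ 4 = φ ^ 4 * b⁻¹ := by
    rw [pow_succ, ← mul_assoc, e3, mul_assoc, hai, mul_assoc]
  have e5 : a * φ ^ 5 = φ ^ 5 * (b⁻¹ * a) := by
    rw [pow_succ, ← mul_assoc, e4, mul_assoc, hbi, mul_assoc]
  have : j = 0 ∨ j = 1 ∨ j = 2 ∨ j = 3 ∨ j = 4 ∨ j = 5 := by revert j; decide
  rcases this with rfl | rfl | rfl | rfl | rfl | rfl
  · change a * φ ^ 0 = φ ^ 0 * (a ^ (1 : ℤ) * b ^ (0 : ℤ)); simp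
  · change a * φ ^ 1 = φ ^ 1 * (a ^ (0 : ℤ) * b ^ (1 : ℤ)); simpa using h1
  · change a * φ ^ 2 = φ ^ 2 * (a ^ (-1 : ℤ) * b ^ (1 : ℤ)); simpa using e2
  · change a * φ ^ 3 = φ ^ 3 * (a ^ (-1 : ℤ) * b ^ (0 : ℤ)); simpa using e3
  · change a * φ ^ 4 = φ ^ 4 * (a ^ (0 : ℤ) * b ^ (-1 : ℤ)); simpa using e4
  · change a * φ ^ 5 = φ ^ 5 * (a ^ (1 : ℤ) * b ^ (-1 : ℤ))
    rw [e5, zpow_one, zpow_neg_one, hc.inv_right.eq]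

end HexagonalGroup

/-! ### The unfolding of the drawing onto the hexagonal tiling. -/

namespace RotationSystem

variable {V : Type*} {G : SimpleGraph V} (M : RotationSystem G)

theorem faceNext_apply (d : G.Dart) : M.faceNext d = M.rot.symm d.symm := rfl

theorem rot_faceNext (d : G.Dart) : M.rot (M.faceNext d) = d.symm := by
  rw [faceNext_apply, Equiv.apply_symm_apply]

theorem zigzagStep_false (d : G.Dart) : M.zigzagStep (d, false) = (M.faceNext d, true) := rfl

theorem zigzagStep_true (d : G.Dart) : M.zigzagStep (d, true) = (M.rot d.symm, false) := rfl

/-- Every vertex has degree `3`, every face has three or six sides. -/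
structure IsHexagonal : Prop where
  connected : G.Connected
  cubic : ∀ v : V, (G.neighborSet v).ncard = 3
  faceDegree_eq : ∀ d : G.Dart, M.faceDegree d = 3 ∨ M.faceDegree d = 6

variable {M}

theorem IsType3.isHexagonal {n : ℕ} (hM : M.IsType3 n) : M.IsHexagonal :=
  ⟨hM.isPlane.1, hM.cubic, hM.faceDegree_eq⟩

theorem IsHexagonal.rot_pow_apply_eq_iff (hM : M.IsHexagonal) (d : G.Dart) (k : ℕ) :
    (M.rot ^ k) d = d ↔ 3 ∣ k := by
  have hcard : {d' : G.Dart | d'.fst = d.fst}.ncard = 3 := by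
    rw [← hM.cubic d.fst]
    refine Set.ncard_congr (fun d' _ => d'.snd) ?_ ?_ ?_
    · rintro d' (h : d'.fst = d.fst)
      rw [← h]; exact d'.adj
    · rintro a b (ha : a.fst = _) (hb : b.fst = _) h
      exact SimpleGraph.Dart.ext _ _ (Prod.ext (ha.trans hb.symm) h)
    · intro w hw
      exact ⟨⟨(d.fst, w), hw⟩, rfl, rfl⟩
  have hfin : {d' : G.Dart | d'.fst = d.fst}.Finite := Set.finite_of_ncard_ne_zero (by omega)
  have hc : M.rot.IsCycleOn (hfin.toFinset : Set G.Dart) := by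
    rw [Set.Finite.coe_toFinset]
    refine ⟨⟨fun x hx => (M.fst_rot x).trans hx, M.rot.injective.injOn, fun x hx =>
      ⟨M.rot.symm x, ?_, by simp⟩⟩, fun x hx y hy => M.sameCycle x y (hx.trans hy.symm)⟩
    have := M.fst_rot (M.rot.symm x)
    rw [Equiv.apply_symm_apply] at this
    exact this.symm.trans hx
  rw [hc.pow_apply_eq (by simp), ← Set.ncard_eq_toFinset_card _ hfin, hcard]

theorem IsHexagonal.exists_rot_pow_eq (hM : M.IsHexagonal) {d d' : G.Dart} (h : d.fst = d'.fst) :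
    ∃ k < 3, (M.rot ^ k) d = d' := by
  obtain ⟨k, hk⟩ := M.sameCycle d d' h
  have h3 : M.rot ^ 3 = 1 := Equiv.ext fun d => (hM.rot_pow_apply_eq_iff d 3).2 dvd_rfl
  refine ⟨(k % 3).toNat, by omega, ?_⟩
  rw [← hk, zpow_eq_zpow_emod' k h3, ← zpow_natCast]
  congr 2
  omega

theorem IsHexagonal.rot_pow_three (hM : M.IsHexagonal) : M.rot ^ 3 = 1 :=
  Equiv.ext fun d => (hM.rot_pow_apply_eq_iff d 3).2 dvd_rfl

theorem faceNext_pow_apply_eq_iff (d : G.Dart) (k : ℕ) :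
    (M.faceNext ^ k) d = d ↔ M.faceDegree d ∣ k := by
  rw [faceDegree, ← Function.isPeriodicPt_iff_minimalPeriod_dvd, Equiv.Perm.coe_pow]; rfl

/-- Here a triangle becomes a hexagon wrapped twice. -/
theorem IsHexagonal.faceNext_pow_six (hM : M.IsHexagonal) : M.faceNext ^ 6 = 1 := by
  refine Equiv.ext fun d => (faceNext_pow_apply_eq_iff d 6).2 ?_
  rcases hM.faceDegree_eq d with h | h <;> simp [h]

theorem IsHexagonal.faceNext_pow_three_apply_eq_iff (hM : M.IsHexagonal) (d : G.Dart) :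
    (M.faceNext ^ 3) d = d ↔ M.faceDegree d = 3 := by
  rw [faceNext_pow_apply_eq_iff]
  rcases hM.faceDegree_eq d with h | h <;> simp [h]

/-- Dart reversal as a permutation. -/
def symmPerm (G : SimpleGraph V) : Equiv.Perm G.Dart :=
  SimpleGraph.Dart.symm_involutive.toPerm

theorem symmPerm_apply (d : G.Dart) : symmPerm G d = d.symm := rfl

theorem symmPerm_mul_self : symmPerm G * symmPerm G = 1 :=
  Equiv.ext fun d => SimpleGraph.Dart.symm_symm d

theorem IsHexagonal.faceNext_mul_symmPerm_pow_three (hM : M.IsHexagonal) :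
    (M.faceNext * symmPerm G) ^ 3 = 1 := by
  have : M.faceNext * symmPerm G = M.rot⁻¹ := by
    ext1 d
    rw [Equiv.Perm.mul_apply, symmPerm_apply, faceNext_apply, SimpleGraph.Dart.symm_symm]; rfl
  rw [this, inv_pow, hM.rot_pow_three, inv_one]

variable (M) in
/-- The unfolding of the drawing onto the hexagonal tiling of the plane. The darts of the tiling are
the pairs `(p, j)`, where `p` is the centre of the hexagon on the left of the dart, and the centre
of the hexagon on its right is `p + hexUnit j`; the dart `(0, 0)` is sent to `d`. -/
def unfold (d : G.Dart) (p : ℤ × ℤ) (j : ZMod 6) : G.Dart :=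
  (M.faceNext ^ j.val * ((M.faceNext ^ 3 * symmPerm G) ^ p.1 *
    (M.faceNext ^ 2 * symmPerm G * M.faceNext) ^ p.2)) d

theorem unfold_zero_zero (d : G.Dart) : M.unfold d 0 0 = d := by
  simp [unfold]

namespace IsHexagonal

theorem faceNext_pow_val_add (hM : M.IsHexagonal) (i j : ZMod 6) :
    M.faceNext ^ (i + j).val = M.faceNext ^ i.val * M.faceNext ^ j.val := by
  rw [← pow_add, ZMod.val_add, ← pow_eq_pow_mod _ hM.faceNext_pow_six]

theorem faceNext_unfold (hM : M.IsHexagonal) (d : G.Dart) (p : ℤ × ℤ) (j : ZMod 6) :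
    M.faceNext (M.unfold d p j) = M.unfold d p (j + 1) := by
  rw [unfold, unfold, add_comm, hM.faceNext_pow_val_add, show ((1 : ZMod 6).val) = 1 from rfl,
    pow_one, mul_assoc M.faceNext]
  rfl

theorem faceNext_pow_unfold (hM : M.IsHexagonal) (d : G.Dart) (p : ℤ × ℤ) (j : ZMod 6) (k : ℕ) :
    (M.faceNext ^ k) (M.unfold d p j) = M.unfold d p (j + k) := by
  induction k with
  | zero => simp
  | succ k ih =>
    rw [pow_succ', Equiv.Perm.mul_apply, ih, hM.faceNext_unfold, Nat.cast_succ, add_assoc]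

theorem unfold_zero (hM : M.IsHexagonal) (d : G.Dart) (j : ZMod 6) :
    M.unfold d 0 j = (M.faceNext ^ j.val) d := by
  have := hM.faceNext_pow_unfold d 0 0 j.val
  rw [unfold_zero_zero, zero_add, ZMod.natCast_zmod_val] at this
  exact this.symm

/-- Write α = φ³a, where a = φ³α is the unit translation; moving a past φ^j turns it into the
translation by `hexUnit j`. -/
theorem symm_unfold (hM : M.IsHexagonal) (d : G.Dart) (p : ℤ × ℤ) (j : ZMod 6) :
    (M.unfold d p j).symm = M.unfold d (p + hexUnit j) (j + 3) := by
  have h1 := mul_pow_of_relations symmPerm_mul_self hM.faceNext_pow_six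
    hM.faceNext_mul_symmPerm_pow_three j
  have hc := commute_of_relations symmPerm_mul_self hM.faceNext_pow_six
    hM.faceNext_mul_symmPerm_pow_three
  have h2 : symmPerm G = M.faceNext ^ 3 * (M.faceNext ^ 3 * symmPerm G) := by
    rw [← mul_assoc, ← pow_add, hM.faceNext_pow_six, one_mul]
  rw [← symmPerm_apply, h2]
  simp only [unfold]
  rw [add_comm j, hM.faceNext_pow_val_add, ← Equiv.Perm.mul_apply]
  congr 1
  rw [show ((3 : ZMod 6).val) = 3 from rfl]
  generalize M.faceNext ^ 3 * symmPerm G = a at *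
  generalize M.faceNext ^ 2 * symmPerm G * M.faceNext = b at *
  have key : a ^ (hexUnit j).1 * b ^ (hexUnit j).2 * (a ^ p.1 * b ^ p.2) =
      a ^ (p + hexUnit j).1 * b ^ (p + hexUnit j).2 := by
    rw [mul_assoc, ← mul_assoc (b ^ _), ← (hc.zpow_zpow p.1 (hexUnit j).2).eq, Prod.fst_add,
      Prod.snd_add, add_comm p.1, add_comm p.2, zpow_add, zpow_add]
    simp only [mul_assoc]
  rw [← key, mul_assoc (M.faceNext ^ 3) a, ← mul_assoc a, h1]
  simp only [mul_assoc]

theorem rot_unfold (hM : M.IsHexagonal) (d : G.Dart) (p : ℤ × ℤ) (j : ZMod 6) :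
    M.rot (M.unfold d p j) = M.unfold d (p + hexUnit (j - 1)) (j + 2) := by
  have := M.rot_faceNext (M.unfold d p (j - 1))
  rw [hM.faceNext_unfold, hM.symm_unfold, sub_add_cancel] at this
  rw [this]; congr 1; ring

theorem rot_symm_unfold (hM : M.IsHexagonal) (d : G.Dart) (p : ℤ × ℤ) (j : ZMod 6) :
    M.rot (M.unfold d p j).symm = M.unfold d (p + hexUnit (j + 1)) (j - 1) := by
  rw [hM.symm_unfold, hM.rot_unfold, add_assoc, show j + 3 - 1 = j + 2 by ring,
    hexUnit_add_hexUnit_add_two]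
  congr 1
  revert j; decide

/-- The image of the unfolding is closed under rotation about a vertex and under reversal, hence
exhausts the darts of a connected graph. -/
theorem exists_unfold_eq (hM : M.IsHexagonal) (d d' : G.Dart) :
    ∃ p j, M.unfold d p j = d' := by
  have hrot : ∀ k : ℕ, ∀ p j, ∃ p' j', M.unfold d p' j' = (M.rot ^ k) (M.unfold d p j) := by
    intro k
    induction k with
    | zero => intro p j; exact ⟨p, j, rfl⟩
    | succ k ih =>
      intro p j
      obtain ⟨p', j', h⟩ := ih p j
      rw [pow_succ', Equiv.Perm.mul_apply, ← h, hM.rot_unfold]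
      exact ⟨_, _, rfl⟩
  have hfst : ∀ p j (d₂ : G.Dart), d₂.fst = (M.unfold d p j).fst →
      ∃ p' j', M.unfold d p' j' = d₂ := by
    intro p j d₂ h
    obtain ⟨k, -, rfl⟩ := hM.exists_rot_pow_eq h.symm
    exact hrot k p j
  have hv : ∀ v w (_ : G.Walk v w), (∃ p j, (M.unfold d p j).fst = v) →
      ∃ p j, (M.unfold d p j).fst = w := by
    intro v w c
    induction c with
    | nil => exact id
    | cons hvw _ ih =>
      rintro ⟨p, j, h⟩
      obtain ⟨p', j', h'⟩ := hfst p j ⟨(_, _), hvw⟩ h.symm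
      refine ih ⟨p' + hexUnit j', j' + 3, ?_⟩
      rw [← hM.symm_unfold, h']
      rfl
  obtain ⟨c⟩ := hM.connected.preconnected d.fst d'.fst
  obtain ⟨p, j, h⟩ := hv _ _ c ⟨0, 0, by rw [unfold_zero_zero]⟩
  exact hfst p j d' h.symm

end IsHexagonal
end RotationSystem

/-! ### The symmetries of the unfolding: translations and half-turns. -/

namespace RotationSystem

variable {V : Type*} {G : SimpleGraph V} {M : RotationSystem G}

theorem zpow_unfold_of_forall {d : G.Dart} {π : Equiv.Perm G.Dart} {g : ZMod 6 → ℤ × ℤ}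
    (h : ∀ p j, π (M.unfold d p j) = M.unfold d (p + g j) j) (p : ℤ × ℤ) (j : ZMod 6) (s : ℤ) :
    (π ^ s) (M.unfold d p j) = M.unfold d (p + s • g j) j := by
  induction s using Int.induction_on with
  | zero => simp
  | succ n ih => rw [add_comm, zpow_add, zpow_one, Equiv.Perm.mul_apply, ih, h, add_smul, one_smul]
                 congr 1; abel
  | pred n ih =>
    rw [sub_eq_add_neg, add_comm, zpow_add, zpow_neg_one, Equiv.Perm.mul_apply, ih,
      Equiv.Perm.inv_eq_iff_eq, h, add_smul, neg_one_smul]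
    congr 1; abel

namespace IsHexagonal

/-- Two darts of the tiling with the same image have the same image after any motion relative to
them. -/
theorem unfold_move (hM : M.IsHexagonal) {d : G.Dart} {p q : ℤ × ℤ} {j k : ZMod 6}
    (h : M.unfold d p j = M.unfold d q k) (s t : ℤ) (l : ZMod 6) :
    M.unfold d (p + (s • hexUnit j + t • hexUnit (j + 1))) (j + l) =
      M.unfold d (q + (s • hexUnit k + t • hexUnit (k + 1))) (k + l) := by
  have h6 : (6 : ZMod 6) = 0 := rfl
  have hA : ∀ p j, (M.faceNext ^ 3 * symmPerm G) (M.unfold d p j) =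
      M.unfold d (p + hexUnit j) j := by
    intro p j
    rw [Equiv.Perm.mul_apply, symmPerm_apply, hM.symm_unfold, hM.faceNext_pow_unfold]
    congr 1; push_cast; linear_combination h6
  have hB : ∀ p j, (M.faceNext ^ 2 * symmPerm G * M.faceNext) (M.unfold d p j) =
      M.unfold d (p + hexUnit (j + 1)) j := by
    intro p j
    rw [Equiv.Perm.mul_apply, Equiv.Perm.mul_apply, hM.faceNext_unfold, symmPerm_apply,
      hM.symm_unfold, hM.faceNext_pow_unfold]
    congr 1; push_cast; linear_combination h6
  have key : ∀ p j, (M.faceNext ^ l.val * ((M.faceNext ^ 2 * symmPerm G * M.faceNext) ^ t *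
      (M.faceNext ^ 3 * symmPerm G) ^ s)) (M.unfold d p j) =
      M.unfold d (p + (s • hexUnit j + t • hexUnit (j + 1))) (j + l) := by
    intro p j
    rw [Equiv.Perm.mul_apply, Equiv.Perm.mul_apply, zpow_unfold_of_forall hA,
      zpow_unfold_of_forall (g := fun j => hexUnit (j + 1)) hB, hM.faceNext_pow_unfold,
      ZMod.natCast_zmod_val, add_assoc]
  rw [← key, ← key, h]

theorem unfold_add_right (hM : M.IsHexagonal) {d : G.Dart} {p q : ℤ × ℤ} {j k : ZMod 6}
    (h : M.unfold d p j = M.unfold d q k) (l : ZMod 6) :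
    M.unfold d p (j + l) = M.unfold d q (k + l) := by
  simpa using hM.unfold_move h 0 0 l

/-- For parallel darts a motion relative to the dart is the same absolute displacement, so a
coincidence between them is a translation symmetry. -/
theorem unfold_add_left (hM : M.IsHexagonal) {d : G.Dart} {p q : ℤ × ℤ} {j : ZMod 6}
    (h : M.unfold d p j = M.unfold d q j) (v : ℤ × ℤ) (l : ZMod 6) :
    M.unfold d (v + p) l = M.unfold d (v + q) l := by
  have := hM.unfold_move h (-hexHeight (j + 1) v) (hexHeight j v) (l - j)
  rwa [← eq_smul_hexUnit_add_smul_hexUnit, add_sub_cancel, add_comm p, add_comm q] at this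

theorem unfold_ne_unfold_add_one (hM : M.IsHexagonal) (d : G.Dart) (p : ℤ × ℤ) (j : ZMod 6) :
    M.unfold d p j ≠ M.unfold d p (j + 1) := by
  rw [← hM.faceNext_unfold]
  intro h
  have := (faceNext_pow_apply_eq_iff (M.unfold d p j) 1).1 (by rw [pow_one]; exact h.symm)
  rcases hM.faceDegree_eq (M.unfold d p j) with h' | h' <;> rw [h'] at this <;> omega

theorem unfold_ne_unfold_add_two (hM : M.IsHexagonal) (d : G.Dart) (p : ℤ × ℤ) (j : ZMod 6) :
    M.unfold d p j ≠ M.unfold d p (j + 2) := by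
  have h2 := hM.faceNext_pow_unfold d p j 2
  rw [Nat.cast_ofNat] at h2
  rw [← h2]
  intro h
  have := (faceNext_pow_apply_eq_iff (M.unfold d p j) 2).1 h.symm
  rcases hM.faceDegree_eq (M.unfold d p j) with h' | h' <;> rw [h'] at this <;> omega

theorem unfold_ne_rot_unfold (hM : M.IsHexagonal) (d : G.Dart) (p : ℤ × ℤ) (j : ZMod 6) :
    M.unfold d p j ≠ M.unfold d (p + hexUnit (j - 1)) (j + 2) := by
  rw [← hM.rot_unfold]
  intro h
  have := (hM.rot_pow_apply_eq_iff (M.unfold d p j) 1).1 (by rw [pow_one]; exact h.symm)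
  omega

theorem unfold_ne_symm_unfold (hM : M.IsHexagonal) (d : G.Dart) (p : ℤ × ℤ) (j : ZMod 6) :
    M.unfold d p j ≠ M.unfold d (p + hexUnit j) (j + 3) := by
  rw [← hM.symm_unfold]
  exact (SimpleGraph.Dart.symm_ne _).symm

/-- The drawing has no rotational symmetry of order `6` in the universal cover. -/
theorem unfold_zero_ne_unfold_one (hM : M.IsHexagonal) (d : G.Dart) (p q : ℤ × ℤ) :
    M.unfold d p 0 ≠ M.unfold d q 1 := by
  intro h
  -- The coefficients solve p + s u₀ + t u₁ = q + s u₁ + t u₂: both darts are carried to the hexagon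
  -- at the centre of the rotation, where they are consecutive sides.
  have := hM.unfold_move h (p - q).2 (-(p - q).1 - (p - q).2) 0
  refine hM.unfold_ne_unfold_add_one d _ _ (this.trans ?_)
  congr 1
  ext <;> simp [hexUnit, show (1 + 1 : ZMod 6) = 2 from rfl] <;> ring

/-- The drawing has no rotational symmetry of order `3` in the universal cover. -/
theorem unfold_zero_ne_unfold_two (hM : M.IsHexagonal) (d : G.Dart) (p q : ℤ × ℤ) :
    M.unfold d p 0 ≠ M.unfold d q 2 := by
  intro h
  have key := fun s t l => hM.unfold_move h s t l
  -- The residue modulo 3 tells whether the centre of the rotation of order 3 is a hexagon centre or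
  -- a vertex of one of the two kinds.
  obtain ⟨r, hr | hr | hr⟩ : ∃ r : ℤ, (p - q).1 - (p - q).2 = 3 * r ∨
      (p - q).1 - (p - q).2 = 3 * r - 1 ∨ (p - q).1 - (p - q).2 = 3 * r + 1 :=
    ⟨((p - q).1 - (p - q).2 + 1) / 3, by omega⟩ <;>
    simp only [Prod.fst_sub, Prod.snd_sub] at hr
  · refine hM.unfold_ne_unfold_add_two d _ _ ((key (-r) (-r - (p - q).2) 0).trans ?_)
    congr 1
    ext <;> simp [hexUnit, show (2 + 1 : ZMod 6) = 3 from rfl] <;> linarith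
  · refine hM.unfold_ne_rot_unfold d _ _ ((key (-r) (-r - (p - q).2) 1).trans ?_)
    congr 1
    ext <;> simp [hexUnit, show (2 + 1 : ZMod 6) = 3 from rfl] <;> linarith
  · refine hM.unfold_ne_rot_unfold d _ _ ((key (-r) (-r - (p - q).2) 4).trans ?_)
    congr 1
    ext <;> simp [hexUnit, show (2 + 1 : ZMod 6) = 3 from rfl,
      show (4 - 1 : ZMod 6) = 3 from rfl] <;> linarith

end IsHexagonal

variable (M) in
/-- The translations of the tiling that are compatible with the unfolding. -/
def translations (d : G.Dart) : AddSubgroup (ℤ × ℤ) where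
  carrier := {c | ∀ p j, M.unfold d (p + c) j = M.unfold d p j}
  zero_mem' p j := by rw [add_zero]
  add_mem' {a b} ha hb p j := by rw [← add_assoc, hb, ha]
  neg_mem' {a} ha p j := by rw [← ha, neg_add_cancel_right]

theorem unfold_add_of_mem {d : G.Dart} {c : ℤ × ℤ} (hc : c ∈ M.translations d) (p : ℤ × ℤ)
    (j : ZMod 6) : M.unfold d (p + c) j = M.unfold d p j := hc p j

namespace IsHexagonal

theorem unfold_eq_unfold_iff_sub_mem (hM : M.IsHexagonal) {d : G.Dart} {p q : ℤ × ℤ}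
    {j : ZMod 6} : M.unfold d p j = M.unfold d q j ↔ p - q ∈ M.translations d := by
  constructor
  · intro h v l
    have := hM.unfold_add_left h (v - q) l
    rwa [sub_add_cancel, sub_add_eq_add_sub, add_sub_assoc] at this
  · intro h
    rw [← unfold_add_of_mem h q, add_sub_cancel]

variable {d : G.Dart}

/-- The face of `d` is a triangle, so opposite sides of the hexagon at the origin coincide; this
spreads to a half-turn symmetry about the origin. -/
theorem unfold_neg (hM : M.IsHexagonal) (hd : M.faceDegree d = 3) (p : ℤ × ℤ) (j : ZMod 6) :
    M.unfold d (-p) (j + 3) = M.unfold d p j := by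
  have h : M.unfold d 0 3 = M.unfold d 0 0 := by
    rw [hM.unfold_zero, hM.unfold_zero]
    exact (hM.faceNext_pow_three_apply_eq_iff d).2 hd
  have := hM.unfold_move h (-hexHeight 1 p) (hexHeight 0 p) j
  have h0 := eq_smul_hexUnit_add_smul_hexUnit 0 p
  rw [zero_add] at h0
  rw [zero_add (1 : ZMod 6), ← h0, zero_add, zero_add, zero_add] at this
  rw [← this, add_comm j, add_comm (3 : ZMod 6) 1, hexUnit_add_three,
    show (3 : ZMod 6) = 0 + 3 from rfl, hexUnit_add_three, smul_neg, smul_neg, ← neg_add, ← h0]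

/-- The darts of the tiling with the same image as a given one. -/
theorem unfold_eq_unfold_iff (hM : M.IsHexagonal) (hd : M.faceDegree d = 3) {p q : ℤ × ℤ}
    {j k : ZMod 6} : M.unfold d p j = M.unfold d q k ↔
      (k = j ∧ p - q ∈ M.translations d) ∨ (k = j + 3 ∧ p + q ∈ M.translations d) := by
  constructor
  · intro h
    obtain ⟨r, rfl⟩ : ∃ r, k = j + r := ⟨k - j, by ring⟩
    have h0 : M.unfold d p 0 = M.unfold d q r := by
      have := hM.unfold_add_right h (-j)
      rwa [add_neg_cancel, add_neg_cancel_comm] at this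
    -- The last two rotations are the half-turn composed with those already excluded.
    have hr : r = 0 ∨ r = 1 ∨ r = 2 ∨ r = 3 ∨ r = 1 + 3 ∨ r = 2 + 3 := by
      clear h h0; revert r; decide
    rcases hr with rfl | rfl | rfl | rfl | rfl | rfl
    · exact .inl ⟨add_zero j, hM.unfold_eq_unfold_iff_sub_mem.1 h0⟩
    · exact absurd h0 (hM.unfold_zero_ne_unfold_one d p q)
    · exact absurd h0 (hM.unfold_zero_ne_unfold_two d p q)
    · rw [← neg_neg q, ← zero_add (3 : ZMod 6), hM.unfold_neg hd,
        hM.unfold_eq_unfold_iff_sub_mem, sub_neg_eq_add] at h0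
      exact .inr ⟨rfl, h0⟩
    · rw [← neg_neg q, hM.unfold_neg hd] at h0
      exact absurd h0 (hM.unfold_zero_ne_unfold_one d p _)
    · rw [← neg_neg q, hM.unfold_neg hd] at h0
      exact absurd h0 (hM.unfold_zero_ne_unfold_two d p _)
  · rintro (⟨rfl, h⟩ | ⟨rfl, h⟩)
    · exact hM.unfold_eq_unfold_iff_sub_mem.2 h
    · rw [← neg_neg q, hM.unfold_neg hd, hM.unfold_eq_unfold_iff_sub_mem, sub_neg_eq_add]
      exact h

/-- A translation by c composed with the half-turn about 0 is a half-turn about c/2. If c/2 is not a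
lattice point, it is the midpoint of an edge, and a dart would equal its reverse. -/
theorem exists_eq_add_self_of_mem_translations (hM : M.IsHexagonal) (hd : M.faceDegree d = 3)
    {c : ℤ × ℤ} (hc : c ∈ M.translations d) : ∃ z, c = z + z := by
  have key : ∀ z l, c ≠ z + z + hexUnit l := by
    rintro z l rfl
    apply hM.unfold_ne_symm_unfold d z l
    rw [hM.unfold_eq_unfold_iff hd]
    exact .inr ⟨rfl, by rwa [← add_assoc]⟩
  obtain ⟨a, b⟩ := c
  obtain ⟨x, rfl | rfl⟩ := Int.even_or_odd' a <;> obtain ⟨y, rfl | rfl⟩ := Int.even_or_odd' b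
  · exact ⟨(x, y), by ext <;> simp <;> ring⟩
  · exact absurd (by ext <;> simp [hexUnit] <;> ring) (key (x, y) 1)
  · exact absurd (by ext <;> simp [hexUnit] <;> ring) (key (x, y) 0)
  · exact absurd (by ext <;> simp [hexUnit] <;> ring) (key (x + 1, y) 2)

/-- Every dart unfolds to a dart of the tiling in a given one of three pairs of opposite
directions. -/
theorem exists_unfold_eq_of_two_mul_eq (hM : M.IsHexagonal) (hd : M.faceDegree d = 3)
    (p : ℤ × ℤ) {j k : ZMod 6} (h : 2 * j = 2 * k) : ∃ q, M.unfold d q k = M.unfold d p j := by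
  have : k = j ∨ k = j + 3 := by revert j k; decide
  rcases this with rfl | rfl
  · exact ⟨p, rfl⟩
  · exact ⟨-p, hM.unfold_neg hd p j⟩

/-- Translation classes of lattice points correspond to vertices. -/
theorem index_translations (hM : M.IsHexagonal) (hd : M.faceDegree d = 3) :
    (M.translations d).index = Nat.card V := by
  refine Nat.card_congr (Equiv.ofBijective
    (Quotient.lift (fun p => (M.unfold d p 0).fst) fun p q h => ?_) ⟨?_, ?_⟩)
  · have h := QuotientAddGroup.leftRel_apply.1 h
    rw [neg_add_eq_sub, ← hM.unfold_eq_unfold_iff_sub_mem (j := 0)] at h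
    rw [h]
  · rintro ⟨p⟩ ⟨q⟩ (h : (M.unfold d p 0).fst = (M.unfold d q 0).fst)
    refine Quotient.sound (QuotientAddGroup.leftRel_apply.2 ?_)
    obtain ⟨k, hk, h⟩ := hM.exists_rot_pow_eq h
    rw [neg_add_eq_sub, ← hM.unfold_eq_unfold_iff_sub_mem (j := 0),
      ← h]
    interval_cases k
    · rfl
    · rw [pow_one, hM.rot_unfold, hM.unfold_eq_unfold_iff hd] at h
      rcases h with ⟨h, -⟩ | ⟨h, -⟩ <;> exact absurd h (by decide)
    · rw [pow_two, Equiv.Perm.mul_apply, hM.rot_unfold, hM.rot_unfold,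
        hM.unfold_eq_unfold_iff hd] at h
      rcases h with ⟨h, -⟩ | ⟨h, -⟩ <;> exact absurd h (by decide)
  · intro v
    obtain ⟨w, hw⟩ : (G.neighborSet v).Nonempty :=
      Set.nonempty_of_ncard_ne_zero (by rw [hM.cubic]; norm_num)
    obtain ⟨p, j, h⟩ := hM.exists_unfold_eq d ⟨(v, w), hw⟩
    have h1 : (M.unfold d p j).fst = v := by rw [h]
    -- `rot` changes the direction by 2, so one of the three darts at the vertex has direction 0 or
    -- 3; a half-turn brings 3 to 0.
    have : ∃ q k, 2 * k = 2 * (0 : ZMod 6) ∧ (M.unfold d q k).fst = v := by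
      have : 2 * j = 2 * 0 ∨ 2 * (j + 2) = 2 * 0 ∨ 2 * (j + 2 + 2) = 2 * 0 := by
        clear h h1; revert j; decide
      rcases this with h2 | h2 | h2
      · exact ⟨p, j, h2, h1⟩
      · exact ⟨_, _, h2, by rw [← hM.rot_unfold, M.fst_rot, h1]⟩
      · exact ⟨_, _, h2, by rw [← hM.rot_unfold, M.fst_rot, ← hM.rot_unfold, M.fst_rot, h1]⟩
    obtain ⟨q, k, hk, hv⟩ := this
    obtain ⟨q', hq'⟩ := hM.exists_unfold_eq_of_two_mul_eq hd q hk
    exact ⟨Quotient.mk _ q', by rw [← hv, ← hq']; rfl⟩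

end IsHexagonal
end RotationSystem

/-! ### Residues up to sign, and directions up to reversal. -/

/-- The distance from `x` to the nearest multiple of `N`; it classifies integers modulo `N` and up
to sign. -/
def foldAbs (N : ℕ) (x : ℤ) : ℕ := (x : ZMod N).valMinAbs.natAbs

theorem foldAbs_eq_foldAbs_iff {N : ℕ} {x y : ℤ} :
    foldAbs N x = foldAbs N y ↔ (N : ℤ) ∣ x - y ∨ (N : ℤ) ∣ x + y := by
  rw [foldAbs, foldAbs, ZMod.natAbs_valMinAbs_eq_natAbs_valMinAbs, ← Int.cast_neg,
    ZMod.intCast_eq_intCast_iff_dvd_sub, ZMod.intCast_eq_intCast_iff_dvd_sub,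
    ← dvd_neg, neg_sub, ← dvd_neg (b := -y - x), neg_sub, sub_neg_eq_add]

theorem foldAbs_natCast {N x : ℕ} (h : 2 * x ≤ N) : foldAbs N x = x := by
  rw [foldAbs, Int.cast_natCast, ZMod.valMinAbs_natCast_of_le_half (by omega), Int.natAbs_natCast]

theorem two_mul_foldAbs_le {N : ℕ} (hN : 0 < N) (x : ℤ) : 2 * foldAbs N x ≤ N := by
  have : NeZero N := ⟨hN.ne'⟩
  have := ZMod.natAbs_valMinAbs_le (x : ZMod N)
  unfold foldAbs
  omega

theorem foldAbs_foldAbs {N : ℕ} (hN : 0 < N) (x : ℤ) : foldAbs N (foldAbs N x) = foldAbs N x :=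
  foldAbs_natCast (two_mul_foldAbs_le hN x)

/-- Doubling in `ZMod 6` forgets exactly the reversal 3, so `2 * j` encodes an unoriented direction.
-/
theorem two_mul_add_three : ∀ j : ZMod 6, 2 * (j + 3) = 2 * j := by decide

theorem eq_or_eq_add_three_of_two_mul_eq :
    ∀ {j k : ZMod 6}, 2 * j = 2 * k → k = j ∨ k = j + 3 := by decide

/-! ### The width of the translation group in each direction. -/

namespace RotationSystem

variable {V : Type*} {G : SimpleGraph V} {M : RotationSystem G} {d : G.Dart}

variable (M) in
/-- Half the positive generator of the group of heights, in the direction `j`, of the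
translations. -/
noncomputable def width (d : G.Dart) (j : ZMod 6) : ℕ :=
  ((M.translations d).map (hexHeight j)).index / 2

theorem width_add_three (j : ZMod 6) : M.width d (j + 3) = M.width d j := by
  have : (M.translations d).map (hexHeight (j + 3)) = (M.translations d).map (hexHeight j) := by
    ext t
    simp only [AddSubgroup.mem_map]
    constructor <;> rintro ⟨c, hc, rfl⟩ <;>
      exact ⟨-c, neg_mem hc, by simp [hexHeight_add_three]⟩
  rw [width, width, this]

theorem width_congr {j k : ZMod 6} (h : 2 * j = 2 * k) : M.width d j = M.width d k := by
  rcases eq_or_eq_add_three_of_two_mul_eq h with rfl | rfl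
  · rfl
  · exact (width_add_three j).symm

theorem hexHeight_smul_add_one (j : ZMod 6) (t : ℤ) : hexHeight j (t • hexUnit (j + 1)) = t := by
  rw [map_zsmul, hexHeight_hexUnit_add_one, smul_eq_mul, mul_one]

theorem hexHeight_surjective (j : ZMod 6) : Function.Surjective (hexHeight j) :=
  fun t => ⟨_, hexHeight_smul_add_one j t⟩

namespace IsHexagonal

/-- The generator of the heights is the height of some z + z, hence even, so the halving in `width`
is exact. -/
theorem index_map_translations (hM : M.IsHexagonal) (hd : M.faceDegree d = 3) (j : ZMod 6) :
    ((M.translations d).map (hexHeight j)).index = 2 * M.width d j := by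
  obtain ⟨g, hg⟩ := Int.subgroup_cyclic ((M.translations d).map (hexHeight j))
  rw [← AddSubgroup.zmultiples_eq_closure] at hg
  have : g ∈ (M.translations d).map (hexHeight j) := by
    rw [hg]; exact AddSubgroup.mem_zmultiples g
  obtain ⟨c, hc, h⟩ := this
  obtain ⟨z, rfl⟩ := hM.exists_eq_add_self_of_mem_translations hd hc
  rw [width, hg, Int.index_zmultiples]
  rw [map_add] at h
  omega

theorem mem_map_translations_iff (hM : M.IsHexagonal) (hd : M.faceDegree d = 3) {j : ZMod 6}
    {t : ℤ} : (∃ c ∈ M.translations d, hexHeight j c = t) ↔ (2 * M.width d j : ℤ) ∣ t := by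
  have h := hM.index_map_translations hd j
  obtain ⟨g, hg⟩ := Int.subgroup_cyclic ((M.translations d).map (hexHeight j))
  rw [← AddSubgroup.zmultiples_eq_closure] at hg
  have hm : t ∈ (M.translations d).map (hexHeight j) ↔ g ∣ t := by
    rw [hg, Int.mem_zmultiples_iff]
  rw [hg, Int.index_zmultiples] at h
  rw [← AddSubgroup.mem_map, hm, ← Int.natAbs_dvd, h]
  push_cast
  rfl

theorem dvd_hexHeight (hM : M.IsHexagonal) (hd : M.faceDegree d = 3) {c : ℤ × ℤ}
    (hc : c ∈ M.translations d) (j : ZMod 6) : (2 * M.width d j : ℤ) ∣ hexHeight j c :=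
  (hM.mem_map_translations_iff hd).1 ⟨c, hc, rfl⟩

theorem width_pos [Finite V] (hM : M.IsHexagonal) (hd : M.faceDegree d = 3) (j : ZMod 6) :
    0 < M.width d j := by
  have := hM.connected.nonempty
  have h := AddSubgroup.index_map_dvd (M.translations d) (hexHeight_surjective j)
  rw [hM.index_map_translations hd, hM.index_translations hd] at h
  have := Nat.pos_of_dvd_of_pos h Nat.card_pos
  omega

end IsHexagonal

/-! ### Zigzags -/

theorem zigzag_symm (x : G.Dart) (b : Bool) : M.zigzag (x.symm, b) = M.zigzag (x, b) :=
  (Quot.sound (.inr rfl)).symm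

theorem zigzag_zigzagStep (x : G.Dart × Bool) : M.zigzag (M.zigzagStep x) = M.zigzag x :=
  (Quot.sound (.inl rfl)).symm

variable (M) in
/-- The zigzag running in the direction `hexUnit j` through the strip of triangles of the
triangular lattice below the line through `p`. -/
def strip (d : G.Dart) (p : ℤ × ℤ) (j : ZMod 6) : M.Zigzag :=
  M.zigzag (M.unfold d p (j - 2), false)

/-- The direction of the passage of a dart, relative to that of the dart. -/
def turnDir (b : Bool) : ZMod 6 := if b then 1 else 2

namespace IsHexagonal

/-- The two passages of a dart of direction j run in directions j + 1 and j + 2; stepping once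
around the left hexagon turns the first kind into the second. -/
theorem zigzag_unfold (hM : M.IsHexagonal) (d : G.Dart) (p : ℤ × ℤ) (j : ZMod 6) (b : Bool) :
    M.zigzag (M.unfold d p j, b) = M.strip d p (j + turnDir b) := by
  cases b
  · simp [strip, turnDir]
  · rw [strip, ← zigzag_zigzagStep (_, false), zigzagStep_false, hM.faceNext_unfold]
    congr 3
    simp [turnDir]; ring

theorem zigzagBeside_unfold (hM : M.IsHexagonal) (d : G.Dart) (p : ℤ × ℤ) (j : ZMod 6) :
    M.zigzagBeside (M.unfold d p j) = M.strip d p (j + 3) := by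
  rw [zigzagBeside, hM.faceNext_unfold, hM.zigzag_unfold]
  congr 1
  simp [turnDir]; ring

theorem strip_add_hexUnit (hM : M.IsHexagonal) (d : G.Dart) (p : ℤ × ℤ) (j : ZMod 6) :
    M.strip d (p + hexUnit j) j = M.strip d p j := by
  have h := zigzag_zigzagStep (M := M) (M.unfold d p (j - 1), true)
  rw [zigzagStep_true, hM.rot_symm_unfold, hM.zigzag_unfold, hM.zigzag_unfold] at h
  rwa [show j - 1 - 1 + turnDir false = j by simp [turnDir]; ring,
    show j - 1 + turnDir true = j by simp [turnDir], sub_add_cancel] at h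

theorem strip_add_smul (hM : M.IsHexagonal) (d : G.Dart) (p : ℤ × ℤ) (j : ZMod 6) (t : ℤ) :
    M.strip d (p + t • hexUnit j) j = M.strip d p j := by
  induction t using Int.induction_on with
  | zero => simp
  | succ n ih => rw [add_smul, one_smul, ← add_assoc, hM.strip_add_hexUnit, ih]
  | pred n ih => rw [← ih, ← hM.strip_add_hexUnit, sub_smul, one_smul, add_assoc, sub_add_cancel]

/-- The strip is walked backwards, so its other bounding line becomes the reference line. -/
theorem strip_symm (hM : M.IsHexagonal) (d : G.Dart) (p : ℤ × ℤ) (j : ZMod 6) :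
    M.strip d (p + hexUnit (j - 2)) (j + 3) = M.strip d p j := by
  rw [strip, strip, ← zigzag_symm (M.unfold d p (j - 2)), hM.symm_unfold]
  congr 3; ring

theorem strip_neg (hM : M.IsHexagonal) (hd : M.faceDegree d = 3) (p : ℤ × ℤ) (j : ZMod 6) :
    M.strip d (-p) (j + 3) = M.strip d p j := by
  rw [strip, strip, ← hM.unfold_neg hd p]
  congr 3; ring

theorem zigzag_ind {P : M.Zigzag → Prop} (hM : M.IsHexagonal) (d : G.Dart)
    (h : ∀ p j, P (M.strip d p j)) (Z : M.Zigzag) : P Z := by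
  obtain ⟨x, b⟩ := Z
  obtain ⟨p, j, rfl⟩ := hM.exists_unfold_eq d x
  have := h p (j + turnDir b)
  rwa [← hM.zigzag_unfold] at this

end IsHexagonal

variable (M) in
/-- A complete invariant of the zigzag `M.strip d p j`. -/
noncomputable def stripInvariant (d : G.Dart) (p : ℤ × ℤ) (j : ZMod 6) : ZMod 6 × ℕ :=
  (2 * j, foldAbs (4 * M.width d j) (2 * hexHeight j p - 1))

theorem stripInvariant_symm {p q : ℤ × ℤ} {j : ZMod 6} (hq : hexHeight j q = -1) :
    M.stripInvariant d (p + q) (j + 3) = M.stripInvariant d p j := by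
  refine Prod.ext (two_mul_add_three j) ?_
  simp only [stripInvariant]
  rw [width_add_three, foldAbs_eq_foldAbs_iff, hexHeight_add_three, map_add, hq]
  refine .inr ⟨0, ?_⟩
  ring

namespace IsHexagonal

/-- Translations change heights by multiples of 2m. Half-turns reverse both the direction and the
sign of the point, which leaves its height unchanged. The free shift `l` serves both kinds of
passage. -/
theorem stripInvariant_congr (hM : M.IsHexagonal) (hd : M.faceDegree d = 3) {p q : ℤ × ℤ}
    {j k : ZMod 6} (h : M.unfold d p j = M.unfold d q k) (l : ZMod 6) :
    M.stripInvariant d p (j + l) = M.stripInvariant d q (k + l) := by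
  rcases (hM.unfold_eq_unfold_iff hd).1 h with ⟨rfl, hc⟩ | ⟨rfl, hc⟩
  · obtain ⟨c, h⟩ := hM.dvd_hexHeight hd hc (k + l)
    refine Prod.ext rfl (foldAbs_eq_foldAbs_iff.2 (.inl ⟨c, ?_⟩))
    rw [map_sub] at h
    push_cast
    linear_combination 2 * h
  · obtain ⟨c, h⟩ := hM.dvd_hexHeight hd hc (j + l)
    refine Prod.ext (by
      simp only [stripInvariant]; rw [add_right_comm, two_mul_add_three]) ?_
    simp only [stripInvariant]
    rw [add_right_comm, width_add_three, hexHeight_add_three, foldAbs_eq_foldAbs_iff]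
    refine .inl ⟨c, ?_⟩
    rw [map_add] at h
    push_cast
    linear_combination 2 * h

/-- The classification of the zigzags. -/
theorem strip_eq_strip_iff (hM : M.IsHexagonal) (hd : M.faceDegree d = 3) {p q : ℤ × ℤ}
    {j k : ZMod 6} :
    M.strip d p j = M.strip d q k ↔ M.stripInvariant d p j = M.stripInvariant d q k := by
  constructor
  · choose P J hPJ using hM.exists_unfold_eq d
    -- The invariant is defined on states through arbitrary preimages; it does not depend on them
    -- and is constant along the walk and under reversal, so it descends to zigzags.
    let F : G.Dart × Bool → ZMod 6 × ℕ := fun x =>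
      M.stripInvariant d (P x.1) (J x.1 + turnDir x.2)
    have hF : ∀ p j b, F (M.unfold d p j, b) = M.stripInvariant d p (j + turnDir b) :=
      fun p j b => hM.stripInvariant_congr hd (hPJ _) _
    have hrel : ∀ x y : G.Dart × Bool, (y = M.zigzagStep x ∨ y = (x.1.symm, x.2)) →
        F x = F y := by
      rintro ⟨x, b⟩ y hy
      obtain ⟨p, j, rfl⟩ := hM.exists_unfold_eq d x
      rcases hy with rfl | rfl
      · cases b
        · rw [zigzagStep_false, hM.faceNext_unfold, hF, hF]
          congr 1
          simp [turnDir]; ring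
        · rw [zigzagStep_true, hM.rot_symm_unfold, hF, hF]
          have : j - 1 + turnDir false = j + 1 := by simp [turnDir]; ring
          rw [this]
          simp only [stripInvariant, turnDir, if_true, map_add, hexHeight_hexUnit_self, add_zero]
      · rw [hM.symm_unfold, hF, hF, add_right_comm, stripInvariant_symm]
        cases b
        · exact hexHeight_add_two_hexUnit j
        · exact hexHeight_add_one_hexUnit j
    intro h
    have := congrArg (Quot.lift F hrel) h
    change F _ = F _ at this
    rw [hF, hF] at this
    simpa [turnDir] using this
  · intro h
    have h1 : k = j ∨ k = j + 3 :=
      eq_or_eq_add_three_of_two_mul_eq (congrArg Prod.fst h)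
    have key : ∀ q, M.stripInvariant d p j = M.stripInvariant d q j →
        M.strip d p j = M.strip d q j := by
      intro q h
      have key' : ∀ q, (4 * M.width d j : ℤ) ∣ 2 * hexHeight j p - 1 - (2 * hexHeight j q - 1) →
          M.strip d p j = M.strip d q j := by
        rintro q ⟨r, hr⟩
        obtain ⟨c, hc, hcr⟩ := (hM.mem_map_translations_iff hd (j := j)
          (t := hexHeight j p - hexHeight j q)).2 ⟨r, by linarith⟩
        obtain ⟨t, ht⟩ := exists_eq_smul_hexUnit (j := j) (p := p - (q + c))
          (by rw [map_sub, map_add, hcr]; ring)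
        rw [sub_eq_iff_eq_add'.1 ht, hM.strip_add_smul, strip, unfold_add_of_mem hc]
        rfl
      rcases foldAbs_eq_foldAbs_iff.1 (congrArg Prod.snd h) with h | h
      · exact key' q (by exact_mod_cast h)
      -- Reversing the walk and then applying the half-turn replaces the height h of the reference
      -- line by 1 − h, which reduces to the previous case.
      · rw [← hM.strip_symm d q, ← hM.strip_neg hd (q + _)]
        have : j + 3 + 3 = j := by rw [add_assoc, show (3 + 3 : ZMod 6) = 0 from rfl, add_zero]
        rw [this]
        apply key'
        have hu := hexHeight_add_two_hexUnit (j - 2)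
        rw [sub_add_cancel] at hu
        rw [map_neg, map_add, hu]
        push_cast at h
        convert h using 1
        ring
    rcases h1 with rfl | rfl
    · exact key q h
    · have hi := hM.stripInvariant_congr hd (hM.unfold_neg hd (-q) j) 0
      rw [add_zero, add_zero, neg_neg] at hi
      rw [key (-q) (h.trans hi), ← hM.strip_neg hd, neg_neg]

theorem strip_eq_strip_iff_dvd (hM : M.IsHexagonal) (hd : M.faceDegree d = 3) {p q : ℤ × ℤ}
    {j : ZMod 6} : M.strip d p j = M.strip d q j ↔
      (2 * M.width d j : ℤ) ∣ hexHeight j p - hexHeight j q ∨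
      (2 * M.width d j : ℤ) ∣ hexHeight j p - (1 - hexHeight j q) := by
  rw [hM.strip_eq_strip_iff hd, stripInvariant, stripInvariant, Prod.mk.injEq,
    foldAbs_eq_foldAbs_iff, and_iff_right rfl]
  refine or_congr ?_ ?_ <;>
    refine Iff.trans (iff_of_eq (congrArg₂ _ ?_ ?_)) (mul_dvd_mul_iff_left (two_ne_zero (α := ℤ)))
  all_goals push_cast; ring

theorem two_mul_eq_of_strip_eq (hM : M.IsHexagonal) (hd : M.faceDegree d = 3) {p q : ℤ × ℤ}
    {j k : ZMod 6} (h : M.strip d p j = M.strip d q k) : 2 * j = 2 * k :=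
  congrArg Prod.fst ((hM.strip_eq_strip_iff hd).1 h)

theorem zigzag_true_ne_zigzag_false (hM : M.IsHexagonal) (hd : M.faceDegree d = 3) (x : G.Dart) :
    M.zigzag (x, true) ≠ M.zigzag (x, false) := by
  obtain ⟨p, j, rfl⟩ := hM.exists_unfold_eq d x
  rw [hM.zigzag_unfold, hM.zigzag_unfold]
  intro h
  have := hM.two_mul_eq_of_strip_eq hd h
  clear h; revert j; decide

/-! ### Roads -/

theorem road_symm (x : G.Dart) : M.road x.symm = M.road x := (Quot.sound (.inl rfl)).symm

theorem road_unfold_add_three (hM : M.IsHexagonal) (d : G.Dart) (p : ℤ × ℤ) (j : ZMod 6) :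
    M.road (M.unfold d p (j + 3)) = M.road (M.unfold d p j) := by
  have := hM.faceNext_pow_unfold d p j 3
  rw [Nat.cast_ofNat] at this
  rw [← this]
  exact (Quot.sound (.inr rfl)).symm

theorem road_unfold_add_hexUnit (hM : M.IsHexagonal) (d : G.Dart) (p : ℤ × ℤ) (j : ZMod 6) :
    M.road (M.unfold d (p + hexUnit j) j) = M.road (M.unfold d p j) := by
  rw [← hM.road_unfold_add_three, ← hM.symm_unfold, road_symm]

theorem road_unfold_add_smul (hM : M.IsHexagonal) (d : G.Dart) (p : ℤ × ℤ) (j : ZMod 6) (t : ℤ) :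
    M.road (M.unfold d (p + t • hexUnit j) j) = M.road (M.unfold d p j) := by
  induction t using Int.induction_on with
  | zero => simp
  | succ n ih => rw [add_smul, one_smul, ← add_assoc, hM.road_unfold_add_hexUnit, ih]
  | pred n ih =>
    rw [← ih, ← hM.road_unfold_add_hexUnit, sub_smul, one_smul, add_assoc, sub_add_cancel]

end IsHexagonal

variable (M) in
/-- A complete invariant of the road through `M.unfold d p j`. -/
noncomputable def lineInvariant (d : G.Dart) (p : ℤ × ℤ) (j : ZMod 6) : ZMod 6 × ℕ :=
  (2 * j, foldAbs (2 * M.width d j) (hexHeight j p))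

theorem lineInvariant_add_three (p : ℤ × ℤ) (j : ZMod 6) :
    M.lineInvariant d p (j + 3) = M.lineInvariant d p j := by
  refine Prod.ext (two_mul_add_three j) ?_
  simp only [lineInvariant]
  rw [width_add_three, foldAbs_eq_foldAbs_iff, hexHeight_add_three]
  exact .inr ⟨0, by ring⟩

namespace IsHexagonal

theorem lineInvariant_congr (hM : M.IsHexagonal) (hd : M.faceDegree d = 3) {p q : ℤ × ℤ}
    {j k : ZMod 6} (h : M.unfold d p j = M.unfold d q k) :
    M.lineInvariant d p j = M.lineInvariant d q k := by
  rcases (hM.unfold_eq_unfold_iff hd).1 h with ⟨rfl, hc⟩ | ⟨rfl, hc⟩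
  · have h := hM.dvd_hexHeight hd hc k
    refine Prod.ext rfl (foldAbs_eq_foldAbs_iff.2 (.inl ?_))
    rw [map_sub] at h
    exact_mod_cast h
  · have h := hM.dvd_hexHeight hd hc j
    rw [lineInvariant_add_three]
    refine Prod.ext rfl (foldAbs_eq_foldAbs_iff.2 (.inr ?_))
    rw [map_add] at h
    exact_mod_cast h

/-- The classification of the roads. -/
theorem road_unfold_eq_road_unfold_iff (hM : M.IsHexagonal) (hd : M.faceDegree d = 3)
    {p q : ℤ × ℤ} {j k : ZMod 6} : M.road (M.unfold d p j) = M.road (M.unfold d q k) ↔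
      M.lineInvariant d p j = M.lineInvariant d q k := by
  constructor
  · choose P J hPJ using hM.exists_unfold_eq d
    let F : G.Dart → ZMod 6 × ℕ := fun x => M.lineInvariant d (P x) (J x)
    have hF : ∀ p j, F (M.unfold d p j) = M.lineInvariant d p j :=
      fun p j => hM.lineInvariant_congr hd (hPJ _)
    have hrel : ∀ x y : G.Dart, (y = x.symm ∨ y = (M.faceNext)^[3] x) → F x = F y := by
      rintro x y hy
      obtain ⟨p, j, rfl⟩ := hM.exists_unfold_eq d x
      rcases hy with rfl | rfl
      · rw [hM.symm_unfold, hF, hF, lineInvariant_add_three]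
        simp only [lineInvariant, map_add, hexHeight_hexUnit_self, add_zero]
      · rw [← Equiv.Perm.coe_pow, hM.faceNext_pow_unfold, hF, hF, Nat.cast_ofNat,
          lineInvariant_add_three]
    intro h
    have := congrArg (Quot.lift F hrel) h
    change F _ = F _ at this
    rwa [hF, hF] at this
  · intro h
    have h1 : k = j ∨ k = j + 3 :=
      eq_or_eq_add_three_of_two_mul_eq (congrArg Prod.fst h)
    have key : M.lineInvariant d p j = M.lineInvariant d q j →
        M.road (M.unfold d p j) = M.road (M.unfold d q j) := by
      intro h
      have key' : ∀ q, (2 * M.width d j : ℤ) ∣ hexHeight j p - hexHeight j q →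
          M.road (M.unfold d p j) = M.road (M.unfold d q j) := by
        intro q h
        obtain ⟨c, hc, hcr⟩ := (hM.mem_map_translations_iff hd).2 h
        obtain ⟨t, ht⟩ := exists_eq_smul_hexUnit (j := j) (p := p - (q + c))
          (by rw [map_sub, map_add, hcr]; ring)
        rw [sub_eq_iff_eq_add'.1 ht, hM.road_unfold_add_smul, unfold_add_of_mem hc]
      rcases foldAbs_eq_foldAbs_iff.1 (congrArg Prod.snd h) with h | h
      · exact key' q (by exact_mod_cast h)
      · rw [← hM.unfold_neg hd q, hM.road_unfold_add_three]
        apply key'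
        rw [map_neg, sub_neg_eq_add]
        exact_mod_cast h
    rcases h1 with rfl | rfl
    · exact key h
    · rw [lineInvariant_add_three] at h
      rw [key h, hM.road_unfold_add_three]

/-- The face at p is a triangle when the half-turn about p is a symmetry; composed with the
half-turn about 0 it is the translation by 2p. -/
theorem faceDegree_unfold_eq_three_iff (hM : M.IsHexagonal) (hd : M.faceDegree d = 3) {p : ℤ × ℤ}
    {j : ZMod 6} : M.faceDegree (M.unfold d p j) = 3 ↔ p + p ∈ M.translations d := by
  rw [← hM.faceNext_pow_three_apply_eq_iff, hM.faceNext_pow_unfold, eq_comm,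
    hM.unfold_eq_unfold_iff hd, Nat.cast_ofNat]
  constructor
  · rintro (⟨h, -⟩ | ⟨-, h⟩)
    · exact absurd h (by revert j; decide)
    · exact h
  · exact fun h => .inr ⟨rfl, h⟩

/-- A road is a railroad unless it lies at a height that is a multiple of the width. -/
theorem forall_faceDegree_eq_six_iff (hM : M.IsHexagonal) (hd : M.faceDegree d = 3) {p : ℤ × ℤ}
    {j : ZMod 6} : (∀ x, M.road x = M.road (M.unfold d p j) → M.faceDegree x = 6) ↔
      ¬ (M.width d j : ℤ) ∣ hexHeight j p := by
  constructor
  · rintro h ⟨t, ht⟩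
    -- A translation of height 2mt is some 2z, so z is the centre of a triangle at the height mt of
    -- the road.
    obtain ⟨c, hc, hct⟩ := (hM.mem_map_translations_iff hd (j := j)
      (t := 2 * M.width d j * t)).2 ⟨t, rfl⟩
    obtain ⟨z, rfl⟩ := hM.exists_eq_add_self_of_mem_translations hd hc
    have hz : hexHeight j z = hexHeight j p := by rw [map_add] at hct; linarith
    have h1 := h (M.unfold d z j) ((hM.road_unfold_eq_road_unfold_iff hd).2 (by
      simp only [lineInvariant, hz]))
    rw [(hM.faceDegree_unfold_eq_three_iff hd).2 hc] at h1
    omega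
  · intro h x hx
    obtain ⟨q, k, rfl⟩ := hM.exists_unfold_eq d x
    refine (hM.faceDegree_eq _).resolve_left fun h3 => h ?_
    rw [hM.faceDegree_unfold_eq_three_iff hd] at h3
    have hi := (hM.road_unfold_eq_road_unfold_iff hd).1 hx
    have hk : k = j ∨ k = j + 3 :=
      eq_or_eq_add_three_of_two_mul_eq (congrArg Prod.fst hi).symm
    have hi' : M.lineInvariant d q j = M.lineInvariant d p j := by
      rcases hk with rfl | rfl
      · exact hi
      · rwa [lineInvariant_add_three] at hi
    obtain ⟨r, hr⟩ := hM.dvd_hexHeight hd h3 j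
    rw [map_add] at hr
    have hr' : hexHeight j q = M.width d j * r := by linarith
    rcases foldAbs_eq_foldAbs_iff.1 (congrArg Prod.snd hi') with ⟨s, hs⟩ | ⟨s, hs⟩ <;>
      push_cast at hs
    · exact ⟨r - 2 * s, by linear_combination hr' - hs⟩
    · exact ⟨2 * s - r, by linear_combination hs - hr'⟩

end IsHexagonal
end RotationSystem

/-! ### Counting fibres and darts: lengths and intersections of zigzags. -/

theorem AddMonoidHom.ncard_preimage_mul_card {Q A : Type*} [AddGroup Q] [AddGroup A] [Finite Q]
    (g : Q →+ A) (hg : Function.Surjective g) (s : Set A) :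
    (g ⁻¹' s).ncard * Nat.card A = s.ncard * Nat.card Q := by
  classical
  have := Finite.of_surjective g hg
  cases nonempty_fintype Q
  cases nonempty_fintype A
  have hfib : ∀ a, (Finset.univ.filter fun x => g x = a).card =
      (Finset.univ.filter fun x => g x = 0).card := by
    intro a
    obtain ⟨y, rfl⟩ := hg a
    exact Finset.card_bij' (fun x _ => x - y) (fun x _ => x + y) (by simp +contextual)
      (by simp) (by simp) (by simp)
  have hs : ∀ s : Finset A, (Finset.univ.filter fun x => g x ∈ s).card =
      s.card * (Finset.univ.filter fun x => g x = 0).card := by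
    intro s
    rw [Finset.card_eq_sum_card_fiberwise (f := g) (t := s) (fun x hx => by simpa using hx),
      Finset.sum_const_nat]
    intro a ha
    rw [← hfib a, Finset.filter_filter]
    congr 1
    ext x
    simp only [Finset.mem_filter, Finset.mem_univ, true_and]
    exact ⟨fun h => h.2, fun h => ⟨h ▸ ha, h⟩⟩
  have h1 := hs s.toFinset
  have h2 := hs Finset.univ
  simp only [Finset.mem_univ, Finset.filter_true, Finset.card_univ] at h2
  have h3 : (g ⁻¹' s).ncard = (Finset.univ.filter fun x => g x ∈ s.toFinset).card := by
    rw [← Set.ncard_coe_finset]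
    congr 1
    ext; simp
  rw [h3, h1, Nat.card_eq_fintype_card, Nat.card_eq_fintype_card, h2, Set.ncard_eq_toFinset_card']
  ring

theorem SimpleGraph.two_mul_ncard_image_edge {V : Type*} {G : SimpleGraph V} [Finite V]
    (S : Set G.Dart) (hS : ∀ x ∈ S, x.symm ∈ S) :
    2 * (SimpleGraph.Dart.edge '' S).ncard = S.ncard := by
  classical
  have : Finite G.Dart :=
    Finite.of_injective SimpleGraph.Dart.toProd SimpleGraph.Dart.toProd_injective
  cases nonempty_fintype G.Dart
  have h : S.toFinset.card = ∑ e ∈ S.toFinset.image SimpleGraph.Dart.edge,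
      (S.toFinset.filter fun x => x.edge = e).card :=
    Finset.card_eq_sum_card_fiberwise fun x hx => by
      simpa using ⟨x, by simpa using hx, rfl⟩
  rw [Finset.sum_const_nat (m := 2)] at h
  · rw [Set.ncard_eq_toFinset_card' S, h, mul_comm, ← Set.ncard_coe_finset, Finset.coe_image,
      Set.coe_toFinset]
  · intro e he
    obtain ⟨x, hx, rfl⟩ := Finset.mem_image.1 he
    rw [Set.mem_toFinset] at hx
    rw [← Finset.card_pair x.symm_ne.symm]
    congr 1
    ext y
    simp only [Finset.mem_filter, Set.mem_toFinset, Finset.mem_insert, Finset.mem_singleton,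
      SimpleGraph.dart_edge_eq_iff]
    exact ⟨fun h => h.2, fun h => ⟨by rcases h with rfl | rfl; exacts [hx, hS _ hx], h⟩⟩

namespace RotationSystem

variable {V : Type*} {G : SimpleGraph V} {M : RotationSystem G} {d : G.Dart}

instance finite_dart [Finite V] : Finite G.Dart :=
  Finite.of_injective SimpleGraph.Dart.toProd SimpleGraph.Dart.toProd_injective

variable (M) in
/-- The heights, modulo twice the width, of the points above the strips of the zigzag of which one
strip lies below the height `a`. -/
def heightPair (d : G.Dart) (j : ZMod 6) (a : ℤ) : Set (ZMod (2 * M.width d j)) :=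
  {(a : ZMod (2 * M.width d j)), 1 - (a : ZMod (2 * M.width d j))}

namespace IsHexagonal

/-- The height of a translation class, modulo twice the width. -/
noncomputable def heightMod (hM : M.IsHexagonal) (hd : M.faceDegree d = 3) (j : ZMod 6) :
    (ℤ × ℤ) ⧸ M.translations d →+ ZMod (2 * M.width d j) :=
  QuotientAddGroup.lift _ ((Int.castAddHom _).comp (hexHeight j)) fun c hc => by
    have := hM.dvd_hexHeight hd hc j
    rw [AddMonoidHom.mem_ker, AddMonoidHom.comp_apply, Int.coe_castAddHom,
      ZMod.intCast_zmod_eq_zero_iff_dvd]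
    exact_mod_cast this

theorem heightMod_mk (hM : M.IsHexagonal) (hd : M.faceDegree d = 3) (j : ZMod 6) (p : ℤ × ℤ) :
    hM.heightMod hd j (p : (ℤ × ℤ) ⧸ M.translations d) = hexHeight j p := rfl

/-- `hexUnit (j + 1)` and −`hexUnit j` form the basis dual to the heights in directions j and j + 1.
-/
theorem heightMod_prod_surjective (hM : M.IsHexagonal) (hd : M.faceDegree d = 3) (j : ZMod 6) :
    Function.Surjective ((hM.heightMod hd j).prod (hM.heightMod hd (j + 1))) := by
  rintro ⟨a, b⟩
  obtain ⟨a, rfl⟩ := ZMod.intCast_surjective a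
  obtain ⟨b, rfl⟩ := ZMod.intCast_surjective b
  refine ⟨((-b • hexUnit j + a • hexUnit (j + 1) : ℤ × ℤ) : (ℤ × ℤ) ⧸ M.translations d), ?_⟩
  rw [AddMonoidHom.prod_apply, heightMod_mk, heightMod_mk]
  simp only [map_add, map_zsmul, hexHeight_hexUnit_self, hexHeight_hexUnit_add_one,
    hexHeight_add_one_hexUnit]
  simp

theorem heightMod_surjective (hM : M.IsHexagonal) (hd : M.faceDegree d = 3) (j : ZMod 6) :
    Function.Surjective (hM.heightMod hd j) :=
  fun a => (hM.heightMod_prod_surjective hd j (a, 0)).imp fun _ h => congrArg Prod.fst h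

/-- The darts of the drawing obtained from the darts of the tiling in a given direction. -/
def unfoldQuot (hM : M.IsHexagonal) (d : G.Dart) (j : ZMod 6) :
    (ℤ × ℤ) ⧸ M.translations d → G.Dart :=
  Quotient.lift (fun p => M.unfold d p j) fun p q h => by
    have h := QuotientAddGroup.leftRel_apply.1 h
    rw [neg_add_eq_sub, ← hM.unfold_eq_unfold_iff_sub_mem (j := j)] at h
    exact h.symm

theorem unfoldQuot_injective (hM : M.IsHexagonal) (d : G.Dart) (j : ZMod 6) :
    Function.Injective (hM.unfoldQuot d j) := by
  rintro ⟨p⟩ ⟨q⟩ (h : M.unfold d p j = M.unfold d q j)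
  refine Quotient.sound (QuotientAddGroup.leftRel_apply.2 ?_)
  rwa [neg_add_eq_sub, ← hM.unfold_eq_unfold_iff_sub_mem (j := j), eq_comm]

theorem finite_quotient [Finite V] (hM : M.IsHexagonal) (d : G.Dart) :
    Finite ((ℤ × ℤ) ⧸ M.translations d) :=
  Finite.of_injective _ (hM.unfoldQuot_injective d 0)

theorem card_quotient (hM : M.IsHexagonal) (hd : M.faceDegree d = 3) :
    Nat.card ((ℤ × ℤ) ⧸ M.translations d) = Nat.card V := hM.index_translations hd

theorem strip_eq_strip_iff_heightMod (hM : M.IsHexagonal) (hd : M.faceDegree d = 3) {p q : ℤ × ℤ}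
    {j : ZMod 6} : M.strip d p j = M.strip d q j ↔
      hM.heightMod hd j (p : (ℤ × ℤ) ⧸ M.translations d) ∈
        M.heightPair d j (hexHeight j q) := by
  rw [hM.strip_eq_strip_iff_dvd hd, heightMod_mk, heightPair, Set.mem_insert_iff,
    Set.mem_singleton_iff,
    show (1 - (hexHeight j q : ZMod (2 * M.width d j))) = ((1 - hexHeight j q : ℤ) : ZMod _) by
      push_cast; rfl,
    eq_comm, ZMod.intCast_eq_intCast_iff_dvd_sub,
    eq_comm (a := (hexHeight j p : ZMod (2 * M.width d j))),
    ZMod.intCast_eq_intCast_iff_dvd_sub]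
  push_cast
  rfl

/-- The two heights differ since 2a − 1 is odd and the modulus is even. -/
theorem ncard_pair_heights (d : G.Dart) (j : ZMod 6) (a : ℤ) :
    (M.heightPair d j a).ncard = 2 := by
  refine Set.ncard_pair fun h => ?_
  rw [← Int.cast_one, ← Int.cast_sub, ZMod.intCast_eq_intCast_iff_dvd_sub] at h
  obtain ⟨t, ht⟩ := h
  push_cast at ht
  have : (2 : ℤ) ∣ 1 - 2 * a := ⟨M.width d j * t, by linarith⟩
  omega

/-- The passages of a zigzag, counted by darts. -/
theorem ncard_zigzag_false_eq_mul_width [Finite V] (hM : M.IsHexagonal) (hd : M.faceDegree d = 3)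
    (q : ℤ × ℤ) (j : ZMod 6) :
    {x : G.Dart | M.zigzag (x, false) = M.strip d q j}.ncard * M.width d j = Nat.card V := by
  have := hM.finite_quotient d
  -- Up to a half-turn every such dart has direction j − 2, so it is counted by one translation
  -- class.
  have hrange : {x : G.Dart | M.zigzag (x, false) = M.strip d q j} ⊆
      Set.range (hM.unfoldQuot d (j - 2)) := by
    intro x hx
    obtain ⟨p, k, rfl⟩ := hM.exists_unfold_eq d x
    rw [Set.mem_ofPred_eq, hM.zigzag_unfold] at hx
    have h := hM.two_mul_eq_of_strip_eq hd hx
    obtain ⟨p', h'⟩ := hM.exists_unfold_eq_of_two_mul_eq hd p (j := k) (k := j - 2) (by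
      clear hx; revert j k; decide)
    exact ⟨p', h'⟩
  rw [← Set.ncard_preimage_of_injective_subset_range (hM.unfoldQuot_injective d _) hrange]
  have hpre : hM.unfoldQuot d (j - 2) ⁻¹' {x | M.zigzag (x, false) = M.strip d q j} =
      hM.heightMod hd j ⁻¹' (M.heightPair d j (hexHeight j q)) := by
    ext x
    obtain ⟨p, rfl⟩ := QuotientAddGroup.mk_surjective x
    exact hM.strip_eq_strip_iff_heightMod hd
  have := (hM.heightMod hd j).ncard_preimage_mul_card (hM.heightMod_surjective hd j)
    (M.heightPair d j (hexHeight j q))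
  rw [ncard_pair_heights, Nat.card_zmod, hM.card_quotient hd, ← hpre] at this
  linarith

/-- One step of the walk matches the two kinds of passage, so they are equally many; each passage of
an edge is seen by its two darts. -/
theorem _root_.RotationSystem.Zigzag.length_eq_ncard [Finite V] (Z : M.Zigzag) :
    Z.length = {x : G.Dart | M.zigzag (x, false) = Z}.ncard := by
  have hsymm : ∀ b, ∀ x ∈ {x : G.Dart | M.zigzag (x, b) = Z},
      x.symm ∈ {x : G.Dart | M.zigzag (x, b) = Z} := fun b x hx => (zigzag_symm x b).trans hx
  have h1 := SimpleGraph.two_mul_ncard_image_edge _ (hsymm true)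
  have h2 := SimpleGraph.two_mul_ncard_image_edge _ (hsymm false)
  have h3 : {x : G.Dart | M.zigzag (x, true) = Z} =
      M.faceNext '' {x : G.Dart | M.zigzag (x, false) = Z} := by
    rw [Equiv.image_eq_preimage_symm]
    ext x
    have := zigzag_zigzagStep (M := M) (M.faceNext.symm x, false)
    rw [zigzagStep_false, Equiv.apply_symm_apply] at this
    rw [Set.mem_preimage, Set.mem_ofPred_eq, this, Set.mem_ofPred_eq]
  have h4 : {x : G.Dart | M.zigzag (x, true) = Z}.ncard =
      {x : G.Dart | M.zigzag (x, false) = Z}.ncard := by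
    rw [h3, Set.ncard_image_of_injective _ M.faceNext.injective]
  have hinj : ∀ b : Bool, Function.Injective fun e : Sym2 V => (e, b) :=
    fun b e e' h => congrArg Prod.fst h
  have h5 : Z.passages =
      (fun e => (e, true)) '' (SimpleGraph.Dart.edge '' {x | M.zigzag (x, true) = Z}) ∪
      (fun e => (e, false)) '' (SimpleGraph.Dart.edge '' {x | M.zigzag (x, false) = Z}) := by
    ext ⟨e, b⟩
    cases b <;> simp [Zigzag.passages, and_comm]
  rw [Zigzag.length, h5, Set.ncard_union_eq, Set.ncard_image_of_injective _ (hinj true),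
    Set.ncard_image_of_injective _ (hinj false)]
  · omega
  · rw [Set.disjoint_left]
    rintro _ ⟨e, -, rfl⟩ ⟨e', -, h⟩
    exact Bool.false_ne_true (congrArg Prod.snd h)

theorem length_strip_mul_width [Finite V] (hM : M.IsHexagonal) (hd : M.faceDegree d = 3)
    (q : ℤ × ℤ) (j : ZMod 6) : (M.strip d q j).length * M.width d j = Nat.card V := by
  rw [Zigzag.length_eq_ncard, hM.ncard_zigzag_false_eq_mul_width hd]

theorem mem_edges_iff {Z : M.Zigzag} {x : G.Dart} :
    x.edge ∈ Z.edges ↔ ∃ b, M.zigzag (x, b) = Z := by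
  constructor
  · rintro ⟨b, y, hy, h⟩
    rcases SimpleGraph.dart_edge_eq_iff _ _ |>.1 hy with rfl | rfl
    · exact ⟨b, h⟩
    · exact ⟨b, by rwa [zigzag_symm] at h⟩
  · rintro ⟨b, h⟩
    exact ⟨b, x, rfl, h⟩

theorem exists_dart_of_mem_edges {Z : M.Zigzag} {e : Sym2 V} (h : e ∈ Z.edges) :
    ∃ x : G.Dart, x.edge = e :=
  let ⟨_, x, hx, _⟩ := h
  ⟨x, hx⟩

theorem isSimple (hM : M.IsHexagonal) (hd : M.faceDegree d = 3) (Z : M.Zigzag) : Z.IsSimple := by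
  rintro e ⟨⟨x, rfl, hx⟩, y, hy, h⟩
  apply hM.zigzag_true_ne_zigzag_false hd x
  rw [hx]
  rcases SimpleGraph.dart_edge_eq_iff _ _ |>.1 hy with rfl | rfl
  · exact h.symm
  · rw [← h, zigzag_symm]

/-- A common edge would be passed once by each zigzag, and the two passages of an edge are never
parallel. -/
theorem inter_edges_eq_empty (hM : M.IsHexagonal) (hd : M.faceDegree d = 3) {p q : ℤ × ℤ}
    {j k : ZMod 6} (h : 2 * j = 2 * k) (hne : M.strip d p j ≠ M.strip d q k) :
    (M.strip d p j).edges ∩ (M.strip d q k).edges = ∅ := by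
  rw [Set.eq_empty_iff_forall_notMem]
  rintro e ⟨he, he'⟩
  obtain ⟨x, rfl⟩ := exists_dart_of_mem_edges he
  obtain ⟨b, hb⟩ := mem_edges_iff.1 he
  obtain ⟨b', hb'⟩ := mem_edges_iff.1 he'
  have hbb : b ≠ b' := by
    rintro rfl
    exact hne (hb.symm.trans hb')
  obtain ⟨r, l, rfl⟩ := hM.exists_unfold_eq d x
  rw [hM.zigzag_unfold] at hb hb'
  have h1 := hM.two_mul_eq_of_strip_eq hd hb
  have h2 := hM.two_mul_eq_of_strip_eq hd hb'
  rw [← h, ← h1] at h2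
  clear hb hb' he he' hne h h1
  revert l b b'
  decide

/-- A common edge corresponds to two darts of direction j − 1 up to half-turns. Such a dart must
have one of two heights modulo 2m and one of two modulo 2m', and the joint height map has fibres of
size n/(4mm'). -/
theorem ncard_inter_edges_add_one [Finite V] (hM : M.IsHexagonal) (hd : M.faceDegree d = 3)
    (q q' : ℤ × ℤ) (j : ZMod 6) :
    2 * M.width d j * M.width d (j + 1) *
      ((M.strip d q j).edges ∩ (M.strip d q' (j + 1)).edges).ncard = Nat.card V := by
  have := hM.finite_quotient d
  set S := {x : G.Dart | M.zigzag (x, true) = M.strip d q j ∧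
    M.zigzag (x, false) = M.strip d q' (j + 1)} with hS
  have hedges : (M.strip d q j).edges ∩ (M.strip d q' (j + 1)).edges =
      SimpleGraph.Dart.edge '' S := by
    ext e
    constructor
    · rintro ⟨he, he'⟩
      obtain ⟨x, rfl⟩ := exists_dart_of_mem_edges he
      obtain ⟨b, hb⟩ := mem_edges_iff.1 he
      obtain ⟨b', hb'⟩ := mem_edges_iff.1 he'
      obtain ⟨r, l, rfl⟩ := hM.exists_unfold_eq d x
      have h1 := hb
      have h2 := hb'
      rw [hM.zigzag_unfold] at h1 h2
      replace h1 := hM.two_mul_eq_of_strip_eq hd h1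
      replace h2 := hM.two_mul_eq_of_strip_eq hd h2
      have : b = true ∧ b' = false := by
        clear hb hb' he he' hS
        revert l b b' j; decide
      rcases this with ⟨rfl, rfl⟩
      exact ⟨_, ⟨hb, hb'⟩, rfl⟩
    · rintro ⟨x, ⟨h, h'⟩, rfl⟩
      exact ⟨mem_edges_iff.2 ⟨_, h⟩, mem_edges_iff.2 ⟨_, h'⟩⟩
  have hrange : S ⊆ Set.range (hM.unfoldQuot d (j - 1)) := by
    rintro x ⟨hx, -⟩
    obtain ⟨p, k, rfl⟩ := hM.exists_unfold_eq d x
    rw [hM.zigzag_unfold] at hx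
    have h := hM.two_mul_eq_of_strip_eq hd hx
    obtain ⟨p', h'⟩ := hM.exists_unfold_eq_of_two_mul_eq hd p (j := k) (k := j - 1) (by
      clear hx hS hedges; revert j k; decide)
    exact ⟨p', h'⟩
  have hpre : hM.unfoldQuot d (j - 1) ⁻¹' S =
      (hM.heightMod hd j).prod (hM.heightMod hd (j + 1)) ⁻¹'
        (M.heightPair d j (hexHeight j q) ×ˢ
        M.heightPair d (j + 1) (hexHeight (j + 1) q')) := by
    ext x
    obtain ⟨p, rfl⟩ := QuotientAddGroup.mk_surjective x
    rw [Set.mem_preimage, Set.mem_preimage, Set.mem_prod]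
    refine and_congr (Iff.trans ?_ (hM.strip_eq_strip_iff_heightMod hd (p := p)))
      (Iff.trans ?_ (hM.strip_eq_strip_iff_heightMod hd (p := p)))
    · change M.zigzag (M.unfold d p (j - 1), true) = _ ↔ _
      rw [hM.zigzag_unfold, show j - 1 + turnDir true = j by simp [turnDir]]
    · change M.zigzag (M.unfold d p (j - 1), false) = _ ↔ _
      rw [hM.zigzag_unfold, show j - 1 + turnDir false = j + 1 by simp [turnDir]; ring]
  have h2 := SimpleGraph.two_mul_ncard_image_edge S fun x hx =>
    ⟨(zigzag_symm x _).trans hx.1, (zigzag_symm x _).trans hx.2⟩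
  rw [← Set.ncard_preimage_of_injective_subset_range (hM.unfoldQuot_injective d _) hrange,
    hpre] at h2
  have := AddMonoidHom.ncard_preimage_mul_card _ (hM.heightMod_prod_surjective hd j)
    (M.heightPair d j (hexHeight j q) ×ˢ
        M.heightPair d (j + 1) (hexHeight (j + 1) q'))
  rw [← h2, Set.ncard_prod, ncard_pair_heights, ncard_pair_heights, Nat.card_prod, Nat.card_zmod,
    Nat.card_zmod, hM.card_quotient hd, ← hedges] at this
  linarith

/-- The size of the intersection of two zigzags in different directions. -/
theorem ncard_inter_edges [Finite V] (hM : M.IsHexagonal) (hd : M.faceDegree d = 3)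
    (q q' : ℤ × ℤ) {j k : ZMod 6} (h : 2 * j ≠ 2 * k) :
    2 * M.width d j * M.width d k *
      ((M.strip d q j).edges ∩ (M.strip d q' k).edges).ncard = Nat.card V := by
  -- There are three unoriented directions, so two distinct ones are adjacent after a possible
  -- reversal, and a half-turn realizes the reversal.
  have h4 : k = j + 1 ∨ k + 3 = j + 1 ∨ j = k + 1 ∨ j + 3 = k + 1 := by
    revert j k; decide
  rcases h4 with rfl | h | rfl | h
  · exact hM.ncard_inter_edges_add_one hd q q' j
  · rw [← hM.strip_neg hd q', ← width_add_three k, h]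
    exact hM.ncard_inter_edges_add_one hd q _ j
  · rw [Set.inter_comm, mul_right_comm 2]
    exact hM.ncard_inter_edges_add_one hd q' q k
  · rw [← hM.strip_neg hd q, ← width_add_three j, h, Set.inter_comm, mul_right_comm 2]
    exact hM.ncard_inter_edges_add_one hd q' _ k

theorem ker_heightMod (hM : M.IsHexagonal) (hd : M.faceDegree d = 3) (j : ZMod 6) :
    (hM.heightMod hd j).ker =
      AddSubgroup.zmultiples (hexUnit j : (ℤ × ℤ) ⧸ M.translations d) := by
  ext x
  obtain ⟨p, rfl⟩ := QuotientAddGroup.mk_surjective x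
  rw [AddMonoidHom.mem_ker, heightMod_mk, ZMod.intCast_zmod_eq_zero_iff_dvd,
    AddSubgroup.mem_zmultiples_iff]
  constructor
  · intro h
    push_cast at h
    obtain ⟨c, hc, h⟩ := (hM.mem_map_translations_iff hd).2 h
    obtain ⟨t, ht⟩ := exists_eq_smul_hexUnit (j := j) (p := p - c) (by rw [map_sub, h, sub_self])
    refine ⟨t, ?_⟩
    rw [← QuotientAddGroup.mk_zsmul, ← ht, QuotientAddGroup.eq_iff_sub_mem]
    simpa using hc
  · rintro ⟨t, ht⟩
    rw [← QuotientAddGroup.mk_zsmul, QuotientAddGroup.eq_iff_sub_mem] at ht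
    have := hM.dvd_hexHeight hd ht j
    rw [map_sub, map_zsmul, hexHeight_hexUnit_self, smul_zero, zero_sub, dvd_neg] at this
    exact_mod_cast this

/-- The multiples of `hexUnit j` form the kernel of the height map onto ℤ/2m. -/
theorem addOrderOf_hexUnit_mul_width [Finite V] (hM : M.IsHexagonal) (hd : M.faceDegree d = 3)
    (j : ZMod 6) : addOrderOf (hexUnit j : (ℤ × ℤ) ⧸ M.translations d) * (2 * M.width d j) =
      Nat.card V := by
  have := hM.finite_quotient d
  have := (hM.heightMod hd j).ncard_preimage_mul_card (hM.heightMod_surjective hd j) {0}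
  rw [Set.ncard_singleton, one_mul, Nat.card_zmod, hM.card_quotient hd] at this
  rw [← this, ← Nat.card_zmultiples, ← hM.ker_heightMod hd]
  rfl

/-- If r · `hexUnit j` is a translation, it is some 2z, and its height in direction j + 1 is −r. -/
theorem even_addOrderOf_hexUnit (hM : M.IsHexagonal) (hd : M.faceDegree d = 3) (j : ZMod 6) :
    Even (addOrderOf (hexUnit j : (ℤ × ℤ) ⧸ M.translations d)) := by
  have h := addOrderOf_nsmul_eq_zero (hexUnit j : (ℤ × ℤ) ⧸ M.translations d)
  rw [← QuotientAddGroup.mk_nsmul, QuotientAddGroup.eq_zero_iff] at h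
  obtain ⟨z, hz⟩ := hM.exists_eq_add_self_of_mem_translations hd h
  have := congrArg (hexHeight (j + 1)) hz
  rw [map_nsmul, hexHeight_add_one_hexUnit, map_add, smul_neg, nsmul_eq_mul, mul_one] at this
  rw [Nat.even_iff]
  omega

/-- The length of a zigzag is a multiple of four. -/
theorem four_dvd_length [Finite V] (hM : M.IsHexagonal) (hd : M.faceDegree d = 3) (q : ℤ × ℤ)
    (j : ZMod 6) : 4 ∣ (M.strip d q j).length := by
  have h1 := hM.length_strip_mul_width hd q j
  have h2 := hM.addOrderOf_hexUnit_mul_width hd j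
  obtain ⟨r, hr⟩ := hM.even_addOrderOf_hexUnit hd j
  refine ⟨r, Nat.eq_of_mul_eq_mul_right (hM.width_pos hd j) ?_⟩
  rw [h1, ← h2, hr]
  ring

theorem signature_eq_zero (hM : M.IsHexagonal) (hd : M.faceDegree d = 3) (Z : M.Zigzag) :
    Z.signature = (0, 0) := by
  have hstep : ∀ (k : ℕ) x, M.zigzag (M.zigzagStep^[k] x) = M.zigzag x := by
    intro k
    induction k with
    | zero => intro x; rfl
    | succ k ih => intro x; rw [Function.iterate_succ_apply', zigzag_zigzagStep, ih]
  have h1 : Z.typeI = ∅ := by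
    rw [Set.eq_empty_iff_forall_notMem]
    rintro e ⟨x, rfl, rfl, k, hk⟩
    apply hM.zigzag_true_ne_zigzag_false hd x
    rw [← hstep k, hk, zigzag_symm]
  have h2 : Z.typeII = ∅ := by
    rw [Set.eq_empty_iff_forall_notMem]
    rintro e ⟨x, rfl, rfl, k, hk⟩
    apply hM.zigzag_true_ne_zigzag_false hd x
    rw [← hstep k, hk]
  rw [Zigzag.signature, h1, h2, Set.ncard_empty]

end IsHexagonal
end RotationSystem

/-! ### Zigzags as Hamiltonian circuits. -/

theorem SimpleGraph.exists_walk_of_forall_adj {V : Type*} {G : SimpleGraph V} (v : ℕ → V)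
    (hv : ∀ t, G.Adj (v t) (v (t + 1))) (n : ℕ) : ∃ p : G.Walk (v 0) (v n),
      p.support = (List.range (n + 1)).map v ∧ ∀ e ∈ p.edges, ∃ t, e = s(v t, v (t + 1)) := by
  induction n with
  | zero => exact ⟨.nil, by simp, by simp⟩
  | succ n ih =>
    obtain ⟨p, h1, h2⟩ := ih
    refine ⟨p.concat (hv n), ?_, ?_⟩
    · rw [SimpleGraph.Walk.support_concat, h1, List.range_succ (n := n + 1), List.map_append]
      simp
    · intro e he
      rw [SimpleGraph.Walk.edges_concat, List.concat_eq_append, List.mem_append,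
        List.mem_singleton] at he
      rcases he with he | he
      exacts [h2 e he, ⟨n, he⟩]

theorem SimpleGraph.exists_isHamiltonianCycle_of_injOn {V : Type*} [Finite V] [DecidableEq V]
    {G : SimpleGraph V} (v : ℕ → V) (hv : ∀ t, G.Adj (v t) (v (t + 1))) (h3 : 3 ≤ Nat.card V)
    (hclosed : v (Nat.card V) = v 0) (hinj : Set.InjOn v (Set.Iio (Nat.card V))) :
    ∃ p : G.Walk (v 0) (v 0), p.IsHamiltonianCycle ∧ p.edges.length = Nat.card V ∧
      ∀ e ∈ p.edges, ∃ t, e = s(v t, v (t + 1)) := by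
  cases nonempty_fintype V
  obtain ⟨n, hn⟩ : ∃ n, Nat.card V = n + 1 := ⟨Nat.card V - 1, by omega⟩
  rw [hn] at h3 hclosed hinj ⊢
  obtain ⟨p, h1, h2⟩ := exists_walk_of_forall_adj v hv (n + 1)
  have hlen : p.length = n + 1 := by
    have := congrArg List.length h1
    rw [SimpleGraph.Walk.length_support, List.length_map, List.length_range] at this
    omega
  have hnil : ¬ p.Nil := by
    rw [← SimpleGraph.Walk.length_eq_zero_iff]; omega
  have hnodup : p.tail.support.Nodup := by
    rw [SimpleGraph.Walk.support_tail_of_not_nil _ hnil, h1, List.range_succ_eq_map, List.map_cons,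
      List.tail_cons, List.map_map, List.range_succ, List.map_append, List.map_singleton,
      Function.comp_apply, hclosed]
    refine List.nodup_append.2 ⟨List.Nodup.map_on ?_ List.nodup_range, by simp, ?_⟩
    · intro a ha b hb h
      rw [List.mem_range] at ha hb
      have := hinj (show a + 1 < n + 1 by omega) (show b + 1 < n + 1 by omega) h
      omega
    · intro a ha b hb h
      obtain ⟨t, ht, rfl⟩ := List.mem_map.1 ha
      rw [List.mem_singleton] at hb
      rw [List.mem_range] at ht
      have := hinj (show t + 1 < n + 1 by omega) (show 0 < n + 1 by omega) (h.trans hb)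
      omega
  refine ⟨p.copy rfl hclosed, ?_, ?_, ?_⟩
  · rw [SimpleGraph.Walk.isHamiltonianCycle_iff_isCycle_and_length_eq,
      SimpleGraph.Walk.isCycle_iff_isPath_tail_and_le_length, SimpleGraph.Walk.length_copy, hlen,
      ← Nat.card_eq_fintype_card, hn]
    refine ⟨⟨?_, h3⟩, rfl⟩
    generalize v (n + 1) = w at *
    subst hclosed
    exact .mk' hnodup
  · rw [SimpleGraph.Walk.edges_copy, SimpleGraph.Walk.length_edges, hlen]
  · rw [SimpleGraph.Walk.edges_copy]
    exact h2

namespace RotationSystem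

variable {V : Type*} {G : SimpleGraph V} {M : RotationSystem G} {d : G.Dart}

theorem fst_zigzagStep (x : G.Dart × Bool) : (M.zigzagStep x).1.fst = x.1.snd := by
  obtain ⟨x, b⟩ := x
  cases b
  · have := M.fst_rot (M.rot.symm x.symm)
    rw [Equiv.apply_symm_apply] at this
    exact this.symm
  · exact M.fst_rot x.symm

namespace IsHexagonal

theorem zigzagStep_iterate_two_mul (hM : M.IsHexagonal) (d : G.Dart) (p : ℤ × ℤ) (j : ZMod 6)
    (t : ℕ) : M.zigzagStep^[2 * t] (M.unfold d p (j - 2), false) =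
      (M.unfold d (p + t • hexUnit j) (j - 2), false) := by
  induction t with
  | zero => simp
  | succ t ih =>
    rw [mul_add, mul_one, add_comm, Function.iterate_add_apply, ih,
      Function.iterate_succ_apply', Function.iterate_one, zigzagStep_false, hM.faceNext_unfold,
      zigzagStep_true, hM.rot_symm_unfold, add_smul, one_smul, add_assoc, show j - 2 + 1 + 1 = j by ring,
      show j - 2 + 1 - 1 = j - 2 by ring]

theorem zigzagStep_iterate_two_mul_add_one (hM : M.IsHexagonal) (d : G.Dart) (p : ℤ × ℤ)
    (j : ZMod 6) (t : ℕ) : M.zigzagStep^[2 * t + 1] (M.unfold d p (j - 2), false) =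
      (M.unfold d (p + t • hexUnit j) (j - 1), true) := by
  rw [Function.iterate_succ_apply', hM.zigzagStep_iterate_two_mul, zigzagStep_false,
    hM.faceNext_unfold]
  congr 2; ring

/-- The coincidences between origins of darts. -/
theorem fst_unfold_eq_iff (hM : M.IsHexagonal) {p q : ℤ × ℤ} {j k : ZMod 6} :
    (M.unfold d p j).fst = (M.unfold d q k).fst ↔ M.unfold d p j = M.unfold d q k ∨
      M.unfold d (p + hexUnit (j - 1)) (j + 2) = M.unfold d q k ∨
      M.unfold d (p + hexUnit j) (j + 4) = M.unfold d q k := by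
  have h2 : (M.rot ^ 2) (M.unfold d p j) = M.unfold d (p + hexUnit j) (j + 4) := by
    rw [pow_two, Equiv.Perm.mul_apply, hM.rot_unfold, hM.rot_unfold, add_assoc p,
      show j + 2 - 1 = j - 1 + 2 by ring, hexUnit_add_hexUnit_add_two, sub_add_cancel]
    congr 1; ring
  rw [← hM.rot_unfold, ← h2]
  constructor
  · intro h
    obtain ⟨k, hk, h⟩ := hM.exists_rot_pow_eq h
    interval_cases k
    exacts [.inl h, .inr (.inl h), .inr (.inr h)]
  · rintro (h | h | h) <;> rw [← h]
    · rw [M.fst_rot]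
    · rw [pow_two, Equiv.Perm.mul_apply, M.fst_rot, M.fst_rot]

/-- A zigzag visits no vertex twice. -/
theorem injOn_fst_zigzagStep_iterate (hM : M.IsHexagonal) (hd : M.faceDegree d = 3) (p : ℤ × ℤ)
    (j : ZMod 6) : Set.InjOn (fun t => (M.zigzagStep^[t] (M.unfold d p (j - 2), false)).1.fst)
      (Set.Iio (2 * addOrderOf (hexUnit j : (ℤ × ℤ) ⧸ M.translations d))) := by
  have hmem : ∀ a b : ℕ, a < addOrderOf (hexUnit j : (ℤ × ℤ) ⧸ M.translations d) →
      b < addOrderOf (hexUnit j : (ℤ × ℤ) ⧸ M.translations d) →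
      (p + a • hexUnit j) - (p + b • hexUnit j) ∈ M.translations d → a = b := by
    intro a b ha hb h
    rw [add_sub_add_left_eq_sub, ← QuotientAddGroup.eq_iff_sub_mem, QuotientAddGroup.mk_nsmul,
      QuotientAddGroup.mk_nsmul] at h
    exact nsmul_injOn_Iio_addOrderOf ha hb h
  -- Even and odd steps start at opposite kinds of tiling vertices, which only a half-turn
  -- identifies; that would make the odd number 2h − 1 the height of a translation.
  have hne : ∀ a b : ℕ, (M.unfold d (p + a • hexUnit j) (j - 2)).fst ≠
      (M.unfold d (p + b • hexUnit j) (j - 1)).fst := by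
    intro a b h
    rw [hM.fst_unfold_eq_iff, hM.unfold_eq_unfold_iff hd, hM.unfold_eq_unfold_iff hd,
      hM.unfold_eq_unfold_iff hd] at h
    have h' : (p + a • hexUnit j) + hexUnit (j - 2) + (p + b • hexUnit j) ∈ M.translations d := by
      rcases h with (⟨h, -⟩ | ⟨h, -⟩) | (⟨h, -⟩ | ⟨h, -⟩) | (⟨h, -⟩ | ⟨-, h⟩)
      on_goal 6 => exact h
      all_goals exact absurd h (by clear hmem h; revert j; decide)
    have h2 := hexHeight_add_two_hexUnit (j - 2)
    rw [sub_add_cancel] at h2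
    obtain ⟨c, hc⟩ := hM.dvd_hexHeight hd h' j
    simp only [map_add, map_nsmul, hexHeight_hexUnit_self, smul_zero, h2] at hc
    have : (2 : ℤ) ∣ 2 * hexHeight j p - 1 := ⟨M.width d j * c, by linarith⟩
    omega
  have heq : ∀ (a b : ℕ) (l : ZMod 6),
      (M.unfold d (p + a • hexUnit j) l).fst = (M.unfold d (p + b • hexUnit j) l).fst →
      (p + a • hexUnit j) - (p + b • hexUnit j) ∈ M.translations d := by
    intro a b l h
    rw [hM.fst_unfold_eq_iff, hM.unfold_eq_unfold_iff hd, hM.unfold_eq_unfold_iff hd,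
      hM.unfold_eq_unfold_iff hd] at h
    rcases h with (⟨-, h⟩ | ⟨h, -⟩) | (⟨h, -⟩ | ⟨h, -⟩) | (⟨h, -⟩ | ⟨h, -⟩)
    · exact h
    all_goals exact absurd h (by clear hmem hne h; revert l; decide)
  intro s hs t ht h
  rw [Set.mem_Iio] at hs ht
  obtain ⟨a, rfl | rfl⟩ := Nat.even_or_odd' s <;> obtain ⟨b, rfl | rfl⟩ := Nat.even_or_odd' t <;>
    simp only [hM.zigzagStep_iterate_two_mul, hM.zigzagStep_iterate_two_mul_add_one] at h
  · rw [hmem a b (by omega) (by omega) (heq a b _ h)]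
  · exact absurd h (hne a b)
  · exact absurd h.symm (hne b a)
  · rw [hmem a b (by omega) (by omega) (heq a b _ h)]

theorem ncard_edges (hM : M.IsHexagonal) (hd : M.faceDegree d = 3) (Z : M.Zigzag) :
    Z.edges.ncard = Z.length := by
  have : Z.edges = Prod.fst '' Z.passages := by
    ext e
    simp [Zigzag.edges]
  rw [this, Set.InjOn.ncard_image, Zigzag.length]
  rintro ⟨e, b⟩ hb ⟨e', b'⟩ hb' (rfl : e = e')
  have := hM.isSimple hd Z e
  cases b <;> cases b' <;> tauto

/-- With m = 1 the walk closes after 2 · (order of `hexUnit j`) = n steps and repeats no vertex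
before; its edges fill the zigzag, since both sets have n elements. -/
theorem isHamiltonian_strip [Finite V] [DecidableEq V] (hM : M.IsHexagonal)
    (hd : M.faceDegree d = 3) {j : ZMod 6} (hj : M.width d j = 1) (p : ℤ × ℤ) :
    (M.strip d p j).IsHamiltonian := by
  refine ⟨hM.isSimple hd _, ?_⟩
  have hcard := hM.addOrderOf_hexUnit_mul_width hd j
  rw [hj, mul_one, mul_comm] at hcard
  have hpos : 0 < Nat.card V := by
    have := hM.connected.nonempty
    exact Nat.card_pos
  set v : ℕ → V := fun t => (M.zigzagStep^[t] (M.unfold d p (j - 2), false)).1.fst with hv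
  have hsnd : ∀ t, v (t + 1) = (M.zigzagStep^[t] (M.unfold d p (j - 2), false)).1.snd := by
    intro t
    rw [hv]
    simp only [Function.iterate_succ_apply', fst_zigzagStep]
  have hadj : ∀ t, G.Adj (v t) (v (t + 1)) := by
    intro t
    rw [hsnd]
    exact (M.zigzagStep^[t] (M.unfold d p (j - 2), false)).1.adj
  have hedge : ∀ t, s(v t, v (t + 1)) ∈ (M.strip d p j).edges := by
    intro t
    have hz : ∀ t x, M.zigzag (M.zigzagStep^[t] x) = M.zigzag x := by
      intro t
      induction t with
      | zero => intro x; rfl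
      | succ t ih => intro x; rw [Function.iterate_succ_apply', zigzag_zigzagStep, ih]
    rw [hsnd]
    exact mem_edges_iff.2 ⟨_, hz t (M.unfold d p (j - 2), false)⟩
  have h3 : 3 ≤ Nat.card V := by
    obtain ⟨r, hr⟩ := hM.even_addOrderOf_hexUnit hd j
    omega
  have hclosed : v (Nat.card V) = v 0 := by
    have h := addOrderOf_nsmul_eq_zero (hexUnit j : (ℤ × ℤ) ⧸ M.translations d)
    rw [← QuotientAddGroup.mk_nsmul, QuotientAddGroup.eq_zero_iff] at h
    rw [hv, ← hcard]
    simp only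
    rw [hM.zigzagStep_iterate_two_mul, unfold_add_of_mem h]
    rfl
  have hinj := hM.injOn_fst_zigzagStep_iterate hd p j
  rw [hcard] at hinj
  obtain ⟨c, hc, hlen, hce⟩ :=
    SimpleGraph.exists_isHamiltonianCycle_of_injOn v hadj h3 hclosed hinj
  refine ⟨_, c, hc, Set.eq_of_subset_of_ncard_le ?_ ?_ (Set.toFinite _)⟩
  · intro e he
    obtain ⟨t, rfl⟩ := hce e he
    exact hedge t
  · have h1 := hM.length_strip_mul_width hd p j
    rw [hj, mul_one] at h1
    have h2 : {e | e ∈ c.edges} = (c.edges.toFinset : Set (Sym2 V)) := by ext; simp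
    rw [hM.ncard_edges hd, h1, h2, Set.ncard_coe_finset,
      List.toFinset_card_of_nodup hc.isCycle.isTrail.edges_nodup, hlen]

end IsHexagonal

/-! ### The families of zigzags and railroads -/

variable (M) in
/-- The zigzag at distance `k` from the origin in the direction `j`. -/
def zigzagAt (d : G.Dart) (j : ZMod 6) (k : ℕ) : M.Zigzag :=
  M.strip d (((k : ℤ) + 1) • hexUnit (j + 1)) j

namespace IsHexagonal

/-- The values 1, 3, …, 2m − 1 are already reduced modulo 4m and up to sign. -/
theorem stripInvariant_zigzagAt (d : G.Dart) {j : ZMod 6} {k : ℕ} (hk : k < M.width d j) :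
    M.stripInvariant d (((k : ℤ) + 1) • hexUnit (j + 1)) j = (2 * j, 2 * k + 1) := by
  rw [stripInvariant, hexHeight_smul_add_one,
    show 2 * ((k : ℤ) + 1) - 1 = ((2 * k + 1 : ℕ) : ℤ) by push_cast; ring,
    foldAbs_natCast (by omega)]

/-- The strip beside this dart lies between the heights k and k + 1; the next lemma sees the same
strip from its upper line. -/
theorem zigzagBeside_eq_zigzagAt (hM : M.IsHexagonal) (hd : M.faceDegree d = 3) (j : ZMod 6)
    (k : ℕ) : M.zigzagBeside (M.unfold d ((k : ℤ) • hexUnit (j + 1)) j) = M.zigzagAt d j k := by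
  rw [hM.zigzagBeside_unfold, zigzagAt, hM.strip_eq_strip_iff hd, stripInvariant, stripInvariant,
    width_add_three, hexHeight_add_three, hexHeight_smul_add_one, hexHeight_smul_add_one,
    two_mul_add_three]
  exact Prod.ext rfl (foldAbs_eq_foldAbs_iff.2 (.inr ⟨0, by ring⟩))

theorem zigzagBeside_add_three_eq_zigzagAt (hM : M.IsHexagonal) (d : G.Dart) (j : ZMod 6)
    (k : ℕ) : M.zigzagBeside (M.unfold d (((k : ℤ) + 1) • hexUnit (j + 1)) (j + 3)) =
      M.zigzagAt d j k := by
  rw [hM.zigzagBeside_unfold, zigzagAt, add_assoc, show (3 + 3 : ZMod 6) = 0 from rfl, add_zero]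

theorem exists_two_mul_eq {c : Fin 3 → ZMod 6} (hc : Function.Injective fun i => 2 * c i)
    (j : ZMod 6) : ∃ i, 2 * j = 2 * c i := by
  have h01 := hc.ne (show (0 : Fin 3) ≠ 1 by decide)
  have h02 := hc.ne (show (0 : Fin 3) ≠ 2 by decide)
  have h12 := hc.ne (show (1 : Fin 3) ≠ 2 by decide)
  have key : ∀ a b c : ZMod 6, 2 * a ≠ 2 * b → 2 * a ≠ 2 * c → 2 * b ≠ 2 * c →
      2 * j = 2 * a ∨ 2 * j = 2 * b ∨ 2 * j = 2 * c := by
    clear h01 h02 h12 hc; revert j; decide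
  rcases key _ _ _ h01 h02 h12 with h | h | h <;> exact ⟨_, h⟩

/-- The enumeration of the zigzags. -/
theorem bijective_zigzagAt [Finite V] (hM : M.IsHexagonal) (hd : M.faceDegree d = 3)
    {c : Fin 3 → ZMod 6} (hc : Function.Injective fun i => 2 * c i) :
    Function.Bijective fun x : (i : Fin 3) × Fin (M.width d (c i)) =>
      M.zigzagAt d (c x.1) x.2 := by
  constructor
  · rintro ⟨i, k⟩ ⟨j, l⟩ h
    have h := (hM.strip_eq_strip_iff hd).1 h
    rw [stripInvariant_zigzagAt d k.2, stripInvariant_zigzagAt d l.2, Prod.mk.injEq] at h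
    obtain rfl := hc h.1
    have : k = l := Fin.ext (by omega)
    rw [this]
  · refine hM.zigzag_ind d fun p j => ?_
    obtain ⟨i, hi⟩ := exists_two_mul_eq hc j
    have hpos := hM.width_pos hd j
    obtain ⟨t, ht⟩ : ∃ t, foldAbs (4 * M.width d j) (2 * hexHeight j p - 1) = t := ⟨_, rfl⟩
    have h1 := two_mul_foldAbs_le (N := 4 * M.width d j) (by omega) (2 * hexHeight j p - 1)
    have h2 := foldAbs_foldAbs (N := 4 * M.width d j) (by omega) (2 * hexHeight j p - 1)
    rw [foldAbs_eq_foldAbs_iff, ht] at h2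
    -- The reduced value is ±(2h − 1) modulo 4m, hence odd, so it is 2k + 1 for some k < m.
    have h3 : t % 2 = 1 := by
      rcases h2 with ⟨r, hr⟩ | ⟨r, hr⟩ <;> push_cast at hr
      · have : (t : ℤ) = 2 * (hexHeight j p + 2 * (M.width d j * r)) - 1 := by linarith
        omega
      · have : (t : ℤ) = 2 * (2 * (M.width d j * r) - hexHeight j p) + 1 := by linarith
        omega
    have hw := width_congr (M := M) (d := d) hi
    refine ⟨⟨i, (t - 1) / 2, by omega⟩, ?_⟩
    refine (hM.strip_eq_strip_iff hd).2 ?_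
    rw [stripInvariant_zigzagAt d (by omega), stripInvariant, ht, hi]
    exact Prod.ext rfl (by simp only; omega)

variable (M) in
/-- The road at distance `k` from the origin in the direction `j`. -/
def _root_.RotationSystem.roadAt (d : G.Dart) (j : ZMod 6) (k : ℕ) : M.Road :=
  M.road (M.unfold d ((k : ℤ) • hexUnit (j + 1)) j)

theorem lineInvariant_roadAt (d : G.Dart) {j : ZMod 6} {k : ℕ} (hk : k ≤ M.width d j) :
    M.lineInvariant d ((k : ℤ) • hexUnit (j + 1)) j = (2 * j, k) := by
  rw [lineInvariant, hexHeight_smul_add_one, foldAbs_natCast (by omega)]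

theorem faceDegree_eq_six_of_road_eq_roadAt (hM : M.IsHexagonal) (hd : M.faceDegree d = 3)
    {j : ZMod 6} {k : ℕ} (h0 : 0 < k) (hk : k < M.width d j) :
    ∀ x, M.road x = M.roadAt d j k → M.faceDegree x = 6 := by
  rw [roadAt, hM.forall_faceDegree_eq_six_iff hd, hexHeight_smul_add_one]
  intro h
  have := Nat.le_of_dvd h0 (Int.natCast_dvd_natCast.1 h)
  omega

/-- The enumeration of the railroads. -/
theorem bijective_roadAt [Finite V] (hM : M.IsHexagonal) (hd : M.faceDegree d = 3)
    {c : Fin 3 → ZMod 6} (hc : Function.Injective fun i => 2 * c i) :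
    Function.Bijective fun x : (i : Fin 3) × Fin (M.width d (c i) - 1) =>
      -- The shift by one skips height 0, whose road passes through the base triangle.
      (⟨M.roadAt d (c x.1) (x.2 + 1), hM.faceDegree_eq_six_of_road_eq_roadAt hd (by omega)
        (by have := x.2.2; omega)⟩ : M.Railroad) := by
  constructor
  · rintro ⟨i, k⟩ ⟨j, l⟩ h
    have h := (hM.road_unfold_eq_road_unfold_iff hd).1 (congrArg Subtype.val h)
    have hk := k.2
    have hl := l.2
    rw [lineInvariant_roadAt d (by simp only; omega), lineInvariant_roadAt d (by simp only; omega),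
      Prod.mk.injEq] at h
    obtain rfl := hc h.1
    have : k = l := Fin.ext (by simpa using h.2)
    rw [this]
  · rintro ⟨⟨x⟩, hx⟩
    obtain ⟨p, j, rfl⟩ := hM.exists_unfold_eq d x
    have hx' := (hM.forall_faceDegree_eq_six_iff hd).1 hx
    obtain ⟨i, hi⟩ := exists_two_mul_eq hc j
    have hpos := hM.width_pos hd j
    obtain ⟨t, ht⟩ : ∃ t, foldAbs (2 * M.width d j) (hexHeight j p) = t := ⟨_, rfl⟩
    have h1 := two_mul_foldAbs_le (N := 2 * M.width d j) (by omega) (hexHeight j p)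
    have h2 := foldAbs_foldAbs (N := 2 * M.width d j) (by omega) (hexHeight j p)
    rw [foldAbs_eq_foldAbs_iff, ht] at h2
    -- The reduced height t is at most m; excluding multiples of m leaves 0 < t < m.
    have h3 : ¬ (M.width d j : ℤ) ∣ t := by
      contrapose! hx'
      obtain ⟨s, hs⟩ := hx'
      rcases h2 with ⟨r, hr⟩ | ⟨r, hr⟩ <;> push_cast at hr
      · exact ⟨s - 2 * r, by linear_combination hs - hr⟩
      · exact ⟨2 * r - s, by linear_combination hr - hs⟩
    have ht0 : t ≠ 0 := by rintro rfl; exact h3 (dvd_zero _)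
    have htw : t ≠ M.width d j := by rintro rfl; exact h3 dvd_rfl
    have hw := width_congr (M := M) (d := d) hi
    refine ⟨⟨i, t - 1, by omega⟩, Subtype.ext ?_⟩
    refine (hM.road_unfold_eq_road_unfold_iff hd).2 ?_
    simp only [Nat.sub_add_cancel (Nat.pos_of_ne_zero ht0)]
    rw [lineInvariant_roadAt d (by omega), lineInvariant, ht, hi]

end IsHexagonal
end RotationSystem

/-! ### The z-vector, tightness and balance. -/

theorem Multiset.map_univ_val_eq_sum {ι α : Type*} [Fintype ι] (f : ι → α) :
    (Finset.univ : Finset ι).val.map f = ∑ i, ({f i} : Multiset α) := by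
  rw [Finset.sum_eq_multiset_sum, ← Multiset.sum_map_singleton (Multiset.map f _), Multiset.map_map]
  rfl

theorem Finset.sum_singleton_fin (m : ℕ) {α : Type*} (a : α) :
    ∑ _l : Fin m, ({a} : Multiset α) = Multiset.replicate m a := by
  rw [Finset.sum_const, Finset.card_univ, Fintype.card_fin, Multiset.nsmul_singleton]

namespace RotationSystem

variable {V : Type*} {G : SimpleGraph V} {M : RotationSystem G} {d : G.Dart}

namespace IsHexagonal

section

variable [Finite V] {c : Fin 3 → ZMod 6}

/-- The enumeration of the zigzags in three families. -/
noncomputable def zigzagEquiv (hM : M.IsHexagonal) (hd : M.faceDegree d = 3)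
    (hc : Function.Injective fun i => 2 * c i) :
    ((i : Fin 3) × Fin (M.width d (c i))) ≃ M.Zigzag :=
  Equiv.ofBijective _ (hM.bijective_zigzagAt hd hc)

/-- The enumeration of the railroads in three families. -/
noncomputable def railroadEquiv (hM : M.IsHexagonal) (hd : M.faceDegree d = 3)
    (hc : Function.Injective fun i => 2 * c i) :
    ((i : Fin 3) × Fin (M.width d (c i) - 1)) ≃ M.Railroad :=
  Equiv.ofBijective _ (hM.bijective_roadAt hd hc)

theorem zigzagEquiv_apply (hM : M.IsHexagonal) (hd : M.faceDegree d = 3)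
    (hc : Function.Injective fun i => 2 * c i) (x) :
    hM.zigzagEquiv hd hc x = M.zigzagAt d (c x.1) x.2 := rfl

theorem length_zigzagAt_mul_width (hM : M.IsHexagonal) (hd : M.faceDegree d = 3) (j : ZMod 6)
    (k : ℕ) : (M.zigzagAt d j k).length * M.width d j = Nat.card V :=
  hM.length_strip_mul_width hd _ j

theorem length_zigzagAt (hM : M.IsHexagonal) (hd : M.faceDegree d = 3) (j : ZMod 6)
    (k : ℕ) : (M.zigzagAt d j k).length = (M.zigzagAt d j 0).length :=
  Nat.eq_of_mul_eq_mul_right (hM.width_pos hd j)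
    ((hM.length_zigzagAt_mul_width hd j k).trans (hM.length_zigzagAt_mul_width hd j 0).symm)

theorem zVector_eq (hM : M.IsHexagonal) (hd : M.faceDegree d = 3)
    (hc : Function.Injective fun i => 2 * c i) : M.zVector =
      ∑ i, Multiset.replicate (M.width d (c i)) ((M.zigzagAt d (c i) 0).length, (0, 0)) := by
  rw [zVector, Multiset.map_univ_val_eq_sum, ← (hM.zigzagEquiv hd hc).sum_comp,
    Fintype.sum_sigma]
  refine Finset.sum_congr rfl fun i _ => ?_
  simp only [zigzagEquiv_apply, hM.length_zigzagAt hd (c i), hM.signature_eq_zero hd]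
  exact Finset.sum_singleton_fin _ _

theorem card_zigzag (hM : M.IsHexagonal) (hd : M.faceDegree d = 3)
    (hc : Function.Injective fun i => 2 * c i) :
    Nat.card M.Zigzag = M.width d (c 0) + M.width d (c 1) + M.width d (c 2) := by
  rw [← Nat.card_congr (hM.zigzagEquiv hd hc), Nat.card_sigma]
  simp [Fin.sum_univ_three]

theorem card_railroad_add_three (hM : M.IsHexagonal) (hd : M.faceDegree d = 3)
    (hc : Function.Injective fun i => 2 * c i) :
    Nat.card M.Railroad + 3 = M.width d (c 0) + M.width d (c 1) + M.width d (c 2) := by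
  rw [← Nat.card_congr (hM.railroadEquiv hd hc), Nat.card_sigma]
  have h0 := hM.width_pos hd (c 0)
  have h1 := hM.width_pos hd (c 1)
  have h2 := hM.width_pos hd (c 2)
  simp [Fin.sum_univ_three]
  omega

theorem isTight_iff (hM : M.IsHexagonal) (hd : M.faceDegree d = 3)
    (hc : Function.Injective fun i => 2 * c i) : M.IsTight ↔ ∀ i, M.width d (c i) = 1 := by
  have hfin : Finite M.Railroad := Finite.of_equiv _ (hM.railroadEquiv hd hc)
  have h := hM.card_railroad_add_three hd hc
  have h0 := hM.width_pos hd (c 0)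
  have h1 := hM.width_pos hd (c 1)
  have h2 := hM.width_pos hd (c 2)
  rw [IsTight, ← Finite.card_eq_zero_iff, Fin.forall_fin_succ, Fin.forall_fin_two]
  change _ ↔ M.width d (c 0) = 1 ∧ M.width d (c 1) = 1 ∧ M.width d (c 2) = 1
  omega

/-- The intersection vector of a zigzag, as the sum of the contributions of the three families. -/
theorem intersectionVector_zigzagAt (hM : M.IsHexagonal) (hd : M.faceDegree d = 3)
    (hc : Function.Injective fun i => 2 * c i) (x : (i : Fin 3) × Fin (M.width d (c i))) :
    (M.zigzagAt d (c x.1) x.2).intersectionVector = ∑ j, if j = x.1 then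
      Multiset.replicate (M.width d (c j) - 1) 0 else Multiset.replicate (M.width d (c j))
        (Nat.card V / (2 * M.width d (c x.1) * M.width d (c j))) := by
  classical
  obtain ⟨i, k⟩ := x
  set Z := M.zigzagAt d (c i) k with hZ
  let g : M.Zigzag → ℕ := fun W => (Z.edges ∩ W.edges).ncard
  -- Including Z itself gives a sum over all zigzags, which splits into families; the extra term is
  -- cancelled at the end.
  have h1 : {g Z} + Z.intersectionVector = ∑ W, ({g W} : Multiset ℕ) := by
    rw [← Multiset.map_univ_val_eq_sum, ← Finset.insert_erase (Finset.mem_univ Z),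
      Finset.insert_val_of_notMem (Finset.notMem_erase _ _), Multiset.map_cons,
      Multiset.singleton_add, Zigzag.intersectionVector]
  have h2 : ∀ j, ∑ l : Fin (M.width d (c j)), ({g (M.zigzagAt d (c j) l)} : Multiset ℕ) =
      (if j = i then {g Z} else 0) + (if j = i then
      Multiset.replicate (M.width d (c j) - 1) 0 else Multiset.replicate (M.width d (c j))
        (Nat.card V / (2 * M.width d (c i) * M.width d (c j)))) := by
    intro j
    split_ifs with hji
    · subst hji
      rw [← Finset.add_sum_erase _ _ (Finset.mem_univ k), Finset.sum_congr rfl (g := fun _ => {0})]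
      · rw [Finset.sum_const, Finset.card_erase_of_mem (Finset.mem_univ k), Finset.card_univ,
          Fintype.card_fin, Multiset.nsmul_singleton]
      · intro l hl
        have hne : Z ≠ M.zigzagAt d (c j) l := fun h => by
          have := (hM.bijective_zigzagAt hd hc).1 (a₁ := ⟨j, k⟩) (a₂ := ⟨j, l⟩) h
          simp only [Sigma.mk.injEq, heq_eq_eq, true_and] at this
          exact Finset.ne_of_mem_erase hl this.symm
        simp only [g]
        rw [hZ, zigzagAt, zigzagAt, hM.inter_edges_eq_empty hd rfl hne, Set.ncard_empty]
    · rw [zero_add, ← Finset.sum_singleton_fin]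
      refine Finset.sum_congr rfl fun l _ => ?_
      have h := hM.ncard_inter_edges hd (((k : ℕ) + 1 : ℤ) • hexUnit (c i + 1))
        (((l : ℕ) + 1 : ℤ) • hexUnit (c j + 1)) (hc.ne (Ne.symm hji))
      have hpos := Nat.mul_pos (Nat.mul_pos two_pos (hM.width_pos hd (c i)))
        (hM.width_pos hd (c j))
      rw [← h, Nat.mul_div_cancel_left _ hpos]
      rfl
  rw [← (hM.zigzagEquiv hd hc).sum_comp, Fintype.sum_sigma] at h1
  simp only [zigzagEquiv_apply, h2, Finset.sum_add_distrib, Finset.sum_ite_eq', Finset.mem_univ,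
    if_true] at h1
  exact add_left_cancel h1

/-- Equal lengths n/m force equal widths, and exchanging two families of equal width permutes the
contributions to the intersection vectors. -/
theorem isZBalanced (hM : M.IsHexagonal) (hd : M.faceDegree d = 3)
    (hc : Function.Injective fun i => 2 * c i) : M.IsZBalanced := by
  intro Z Z' hlen _
  obtain ⟨⟨i, k⟩, rfl⟩ := (hM.bijective_zigzagAt hd hc).2 Z
  obtain ⟨⟨j, l⟩, rfl⟩ := (hM.bijective_zigzagAt hd hc).2 Z'
  have hw : M.width d (c i) = M.width d (c j) := by
    have hi := hM.length_zigzagAt_mul_width hd (c i) k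
    have hj := hM.length_zigzagAt_mul_width hd (c j) l
    have := hM.connected.nonempty
    have hpos : 0 < Nat.card V := Nat.card_pos
    have hl : 0 < (M.zigzagAt d (c i) k).length := Nat.pos_of_ne_zero fun h => by
      rw [h, zero_mul] at hi; omega
    refine Nat.eq_of_mul_eq_mul_left hl (hi.trans ?_)
    rw [← hj]
    exact congrArg (· * _) hlen.symm
  rw [hM.intersectionVector_zigzagAt hd hc ⟨i, k⟩, hM.intersectionVector_zigzagAt hd hc ⟨j, l⟩]
  refine (Equiv.sum_comp (Equiv.swap i j) _).symm.trans (Finset.sum_congr rfl fun t _ => ?_)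
  have hs : M.width d (c (Equiv.swap i j t)) = M.width d (c t) := by
    rcases eq_or_ne t i with rfl | hi
    · rw [Equiv.swap_apply_left, hw]
    · rcases eq_or_ne t j with rfl | hj
      · rw [Equiv.swap_apply_right, hw]
      · rw [Equiv.swap_apply_of_ne_of_ne hi hj]
  simp only [hs, hw, Equiv.swap_apply_eq_iff, Equiv.swap_apply_left]

end

/-- The darts of a triangle, as darts of a hexagon of the tiling. -/
theorem exists_unfold_zero_eq (hM : M.IsHexagonal) {x : G.Dart} (h : M.face d = M.face x) :
    ∃ j, M.unfold d 0 j = x := by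
  obtain ⟨k, hk⟩ : M.faceNext.SameCycle d x := Quotient.exact h
  refine ⟨k, ?_⟩
  rw [hM.unfold_zero, ← hk, zpow_eq_zpow_emod' k hM.faceNext_pow_six, ← zpow_natCast,
    ZMod.val_intCast]

end IsHexagonal
end RotationSystem

theorem theorem5p4 {V : Type*} [Finite V] [DecidableEq V] {G : SimpleGraph V}
    (M : RotationSystem G) (n : ℕ) (hM : M.IsType3 n) :
    -- all zigzags are simple
    (∀ Z : M.Zigzag, Z.IsSimple) ∧
    -- at least three zigzags, with equality if and only if tight
    3 ≤ Nat.card M.Zigzag ∧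
    (Nat.card M.Zigzag = 3 ↔ M.IsTight) ∧
    -- the tight case
    (M.IsTight →
      M.zVector = Multiset.replicate 3 (n, (0, 0)) ∧ ∀ Z : M.Zigzag, Z.IsHamiltonian) ∧
    M.IsZBalanced ∧
    -- the parameters, for any labelling `e 0, e 1, e 2` of the edges of any triangle
    ∀ e : Fin 3 → G.Dart, Function.Injective e → (∀ i, M.faceDegree (e i) = 3) →
      (∀ i j, M.face (e i) = M.face (e j)) →
      ∃ (s m : Fin 3 → ℕ)
        (Z : ((i : Fin 3) × Fin (m i)) ≃ M.Zigzag)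
        (R : ((i : Fin 3) × Fin (m i - 1)) ≃ M.Railroad),
        -- the first zigzag of the `i`-th family contains the two edges other than `e i`
        (∀ i, ∃ h : 0 < m i, Z ⟨i, ⟨0, h⟩⟩ = M.zigzagBeside (e i)) ∧
        -- consecutive zigzags of a family bound a railroad
        (∀ (i : Fin 3) (k : ℕ) (hk : k + 1 < m i),
          (R ⟨i, ⟨k, by omega⟩⟩).IsBoundedBy (Z ⟨i, ⟨k, by omega⟩⟩) (Z ⟨i, ⟨k + 1, hk⟩⟩)) ∧
        -- lengths, `z`-vector, number of railroads
        (∀ (i : Fin 3) (k : Fin (m i)), (Z ⟨i, k⟩).length = 4 * s i) ∧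
        M.zVector = ∑ i, Multiset.replicate (m i) (4 * s i, (0, 0)) ∧
        Nat.card M.Railroad + 3 = m 0 + m 1 + m 2 ∧
        -- intersections
        (∀ (i : Fin 3) (k l : Fin (m i)), k ≠ l →
          ((Z ⟨i, k⟩).edges ∩ (Z ⟨i, l⟩).edges).ncard = 0) ∧
        (∀ (i j : Fin 3) (k : Fin (m i)) (l : Fin (m j)), i ≠ j →
          (((Z ⟨i, k⟩).edges ∩ (Z ⟨j, l⟩).edges).ncard : ℚ) = (n : ℚ) / (2 * m i * m j)) := by
  have hH := hM.isHexagonal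
  have hn := hM.card_eq
  obtain ⟨d, hd⟩ := hM.exists_triangle
  -- The assertions that involve no labelled triangle can use the directions 0, 1, 2 from any
  -- triangle.
  have hc : Function.Injective fun i : Fin 3 => 2 * (![0, 1, 2] : Fin 3 → ZMod 6) i := by decide
  have hcard := hH.card_zigzag hd hc
  have hcardR := hH.card_railroad_add_three hd hc
  have htight := hH.isTight_iff hd hc
  refine ⟨hH.isSimple hd, by omega, ?_, ?_, hH.isZBalanced hd hc, ?_⟩
  · have h0 := hH.width_pos hd ((![0, 1, 2] : Fin 3 → ZMod 6) 0)
    have h1 := hH.width_pos hd ((![0, 1, 2] : Fin 3 → ZMod 6) 1)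
    have h2 := hH.width_pos hd ((![0, 1, 2] : Fin 3 → ZMod 6) 2)
    rw [htight, hcard, Fin.forall_fin_succ, Fin.forall_fin_two]
    change _ ↔ M.width d 0 = 1 ∧ M.width d 1 = 1 ∧ M.width d 2 = 1
    change 0 < M.width d 0 at h0
    change 0 < M.width d 1 at h1
    change 0 < M.width d 2 at h2
    change M.width d 0 + M.width d 1 + M.width d 2 = 3 ↔ _
    omega
  · intro ht
    have hw := htight.1 ht
    constructor
    · rw [hH.zVector_eq hd hc]
      have : ∀ i, (M.zigzagAt d ((![0, 1, 2] : Fin 3 → ZMod 6) i) 0).length = n := by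
        intro i
        rw [← hn, ← hH.length_zigzagAt_mul_width hd _ 0, hw i, mul_one]
      simp only [hw, this]
      rw [Finset.sum_const, Multiset.nsmul_replicate]
      rfl
    · intro Z
      obtain ⟨x, rfl⟩ := (hH.bijective_zigzagAt hd hc).2 Z
      exact hH.isHamiltonian_strip hd (hw x.1) _
  -- The unfolding is now based at the given triangle, through its side `e 0`.
  · clear! d
    intro e he hd hface
    choose c hce using fun i => hH.exists_unfold_zero_eq (hface 0 i)
    -- Opposite sides of the hexagon at the origin are the same dart of the triangle, so distinct
    -- sides have distinct unoriented directions.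
    have hc : Function.Injective fun i => 2 * c i := by
      intro i j h
      apply he
      rw [← hce i, ← hce j]
      rcases eq_or_eq_add_three_of_two_mul_eq h with h | h
      · rw [h]
      · rw [h, ← hH.unfold_neg (hd 0), neg_zero]
    refine ⟨fun i => (M.zigzagAt (e 0) (c i) 0).length / 4, fun i => M.width (e 0) (c i),
      hH.zigzagEquiv (hd 0) hc, hH.railroadEquiv (hd 0) hc, ?_, ?_, ?_, ?_,
      hH.card_railroad_add_three (hd 0) hc, ?_, ?_⟩
    · intro i
      refine ⟨hH.width_pos (hd 0) _, ?_⟩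
      have := hH.zigzagBeside_eq_zigzagAt (hd 0) (c i) 0
      rw [Nat.cast_zero, zero_smul, hce] at this
      exact this.symm
    · intro i k hk
      -- The road at height k + 1 is entered in the reversed direction, so the zigzag beside it is
      -- the lower one, and the opposite side gives the upper one.
      refine ⟨M.unfold (e 0) (((k : ℤ) + 1) • hexUnit (c i + 1)) (c i + 3), ?_, ?_, ?_⟩
      · rw [hH.road_unfold_add_three, ← Nat.cast_succ]
        rfl
      · rw [hH.zigzagBeside_add_three_eq_zigzagAt]
        rfl
      · rw [← Equiv.Perm.coe_pow, hH.faceNext_pow_unfold, Nat.cast_ofNat, add_assoc,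
          show (3 + 3 : ZMod 6) = 0 from rfl, add_zero, ← Nat.cast_succ,
          hH.zigzagBeside_eq_zigzagAt (hd 0)]
        rfl
    · intro i k
      exact (hH.length_zigzagAt (hd 0) _ _).trans
        (Nat.mul_div_cancel' (hH.four_dvd_length (hd 0) _ _)).symm
    · rw [hH.zVector_eq (hd 0) hc]
      refine Finset.sum_congr rfl fun i _ => ?_
      exact congrArg (fun l => Multiset.replicate (M.width (e 0) (c i)) (l, (0, 0)))
        (Nat.mul_div_cancel' (hH.four_dvd_length (hd 0) _ _)).symm
    · intro i k l hkl
      have hne := (hH.zigzagEquiv (hd 0) hc).injective.ne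
        (a₁ := ⟨i, k⟩) (a₂ := ⟨i, l⟩) (by simpa using hkl)
      rw [RotationSystem.IsHexagonal.zigzagEquiv_apply,
        RotationSystem.IsHexagonal.zigzagEquiv_apply] at hne ⊢
      exact (congrArg Set.ncard (hH.inter_edges_eq_empty (hd 0) rfl hne)).trans (Set.ncard_empty _)
    · intro i j k l hij
      have h := hH.ncard_inter_edges (hd 0) (((k : ℕ) + 1 : ℤ) • hexUnit (c i + 1))
        (((l : ℕ) + 1 : ℤ) • hexUnit (c j + 1)) (hc.ne hij)
      have hi := hH.width_pos (hd 0) (c i)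
      have hj := hH.width_pos (hd 0) (c j)
      rw [hn] at h
      rw [← h, eq_div_iff (by positivity)]
      push_cast
      rw [mul_comm]
      rfl
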